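/- **Setting.** Let $\Omega\subset\mathbb R^d$ (for instance $d=2$) be a bounded open set, let $B_1,B_2\subset\Omega$ be disjoint measurable sets of positive Lebesgue measure, and let $L,\ell,\kappa,\bar\kappa>0$. Put $\mathcal U=H^1_0(\Omega)$, $\mathcal W=H^1(0,L)$, $\mathcal V=\mathcal U\times\mathcal W$ with $$\|(\phi,\theta)\|_{\mathcal V}^2=\|\phi\|_{L^2(\Omega)}^2+\ell^2\|\nabla\phi\|_{L^2(\Omega)}^2+\ell^{d-1}\bigl(\|\theta\|_{L^2(0,L)}^2+L^2\|\theta'\|_{L^2(0,L)}^2\bigr),$$ and $Q=\mathbb R^2$ with the Euclidean norm. Define $$a(\phi,\theta;\psi,\delta)=\int_\Omega\kappa\,\nabla\phi\cdot\nabla\psi\,dV+\int_0^L\bar\kappa\,\theta'\delta'\,dx,$$ $$b(\phi,\theta;\Gamma)=\Gamma_1\Bigl(\theta(0)-\tfrac1{|B_1|}\int_{B_1}\phi\,dV\Bigr)+\Gamma_2\Bigl(\theta(L)-\tfrac1{|B_2|}\int_{B_2}\phi\,dV\Bigr),$$ where $\theta(0),\theta(L)$ are the values of the continuous representative of $\theta$.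 For $f\in\mathcal V'$ the continuous problem is: find $(u,\lambda)\in\mathcal V\times Q$ with $$a(u,v)+b(v,\lambda)=f(v)\quad\forall v\in\mathcal V,\qquad b(u,\Gamma)=0\quad\forall\Gamma\in Q.$$ For a closed linear subspace $\mathcal V_h\subset\mathcal V$ (in particular, any finite-dimensional finite element space) the discrete problem is: find $(u_h,\lambda_h)\in\mathcal V_h\times Q$ with $$a(u_h,v_h)+b(v_h,\lambda_h)=f(v_h)\quad\forall v_h\in\mathcal V_h,\qquad b(u_h,\Gamma)=0\quad\forall\Gamma\in Q.$$ Let $B:\mathcal V\to Q'$, $\langle Bv,\Gamma\rangle=b(v,\Gamma)$, let $B_h=B|_{\mathcal V_h}:\mathcal V_h\to Q'$, and let $\ker B_h^T=\{\Gamma\in Q: b(v_h,\Gamma)=0\ \forall v_h\in\mathcal V_h\}$. Write $\|\Gamma\|_{Q/\ker B_h^T}$ for the distance of $\Gamma$ to $\ker B_h^T$. We say that $\mathcal V_h$ satisfies the discrete inf-sup condition with constant $\beta>0$ if $$\sup_{0\ne v_h\in\mathcal V_h}\frac{b(v_h,\Gamma)}{\|v_h\|_{\mathcal V}}\ \ge\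 \beta\,\|\Gamma\|_{Q/\ker B_h^T}\qquad\forall\,\Gamma\in Q$$ (the supremum being read as $0$ if $\mathcal V_h=\{0\}$). **Theorem.** For every $f\in\mathcal V'$ the continuous problem has exactly one solution $(u,\lambda)$. Moreover there are $\alpha>0$, $\beta_0>0$ and a function $C:(0,\infty)\to\mathbb R$, depending only on $\Omega,B_1,B_2,L,\ell,\kappa,\bar\kappa$ (not on $\mathcal V_h$ or $f$), such that the following holds. 1. *Every conforming space.* For every closed subspace $\mathcal V_h\subset\mathcal V$: $\ker B_h\subset\ker B$; $a(v,v)\ge\alpha\|v\|_{\mathcal V}^2$ for all $v\in\ker B_h$; and $\mathcal V_h$ satisfies the discrete inf-sup condition with some constant $\beta>0$. For every $f\in\mathcal V'$ the discrete problem has a solution $(u_h,\lambda_h)$, in which $u_h$ is unique and $\lambda_h$ is unique modulo $\ker B_h^T$. If $\beta>0$ is any discrete inf-sup constant of $\mathcal V_h$, then $$\|u_h\|_{\mathcal V}+\|\lambda_h\|_{Q/\ker B_h^T}\le C(\beta)\,M$$ whenever $M\ge0$ and $|f(v_h)|\le M\|v_h\|_{\mathcal V}$ for all $v_h\in\mathcal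 V_h$, and $$\|u-u_h\|_{\mathcal V}+\|\lambda-\lambda_h\|_{Q/\ker B_h^T}\le C(\beta)\inf_{v_h\in\mathcal V_h}\|u-v_h\|_{\mathcal V}.$$ 2. *$B_h$ surjective.* If moreover $B_h$ is surjective, then $\ker B_h^T=\{0\}$, the discrete problem has exactly one solution for every $f\in\mathcal V'$, and the two estimates in 1 hold with the Euclidean norms $\|\lambda_h\|$ and $\|\lambda-\lambda_h\|$. 3. *Uniform constants.* If the closed subspace $\mathcal V_h$ contains all pairs $(0,\theta)$ with $\theta$ affine on $(0,L)$, then $B_h$ is surjective and $\mathcal V_h$ satisfies the discrete inf-sup condition with the constant $\beta_0$. Hence the discrete problem has exactly one solution, and, with $c=C(\beta_0)$ independent of $\mathcal V_h$ and $f$, $$\|u-u_h\|_{\mathcal V}+\|\lambda-\lambda_h\|\le c\inf_{v_h\in\mathcal V_h}\|u-v_h\|_{\mathcal V}.$$ -/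

import Mathlib

open MeasureTheory Set
open scoped ContDiff

noncomputable section

namespace LinkedWire

/-! ### Sobolev spaces of order one -/

section Sobolev

variable {E : Type*} [NormedAddCommGroup E] [InnerProductSpace ℝ E] [MeasureSpace E]

/-- `L²(Ω; F)` with respect to Lebesgue measure on `Ω`. -/
abbrev L2 (Ω : Set E) (F : Type*) [NormedAddCommGroup F] := Lp F 2 (volume.restrict Ω)

/-- The Hilbert space `L²(Ω) × L²(Ω; E)`. A Sobolev function `φ` is represented by the pair
`(φ, ∇φ)` of its class and the class of its (unique) weak gradient. -/
abbrev L2Pair (Ω : Set E) := WithLp 2 (L2 Ω ℝ × L2 Ω E)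

/-- Test functions on `Ω`: smooth functions with compact support contained in `Ω`. -/
structure IsTestFunction (Ω : Set E) (η : E → ℝ) : Prop where
  smooth : ContDiff ℝ ∞ η
  compact : HasCompactSupport η
  support : tsupport η ⊆ Ω

/-- `g` is the weak gradient of `φ` on `Ω`: for every test function `η` and direction `v`,
`∫_Ω φ ∂_v η = - ∫_Ω (g · v) η`. -/
def IsWeakGradient (Ω : Set E) (φ : E → ℝ) (g : E → E) : Prop :=
  ∀ η : E → ℝ, IsTestFunction Ω η → ∀ v : E,
    ∫ x in Ω, φ x * fderiv ℝ η x v = - ∫ x in Ω, inner ℝ (g x) v * η x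

variable [BorelSpace E] [IsFiniteMeasureOnCompacts (volume : Measure E)]

theorem IsTestFunction.memLp {Ω : Set E} {η : E → ℝ} (h : IsTestFunction Ω η) :
    MemLp η 2 (volume.restrict Ω) :=
  (h.smooth.continuous.memLp_of_hasCompactSupport (μ := volume) h.compact).restrict Ω

theorem IsTestFunction.memLp_fderiv {Ω : Set E} {η : E → ℝ} (h : IsTestFunction Ω η) (v : E) :
    MemLp (fun x => fderiv ℝ η x v) 2 (volume.restrict Ω) := by
  have hc : Continuous (fun x => fderiv ℝ η x v) :=
    (h.smooth.continuous_fderiv (by simp)).clm_apply continuous_const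
  have hs : HasCompactSupport (fun x => fderiv ℝ η x v) := h.compact.fderiv_apply ℝ v
  exact (hc.memLp_of_hasCompactSupport (μ := volume) hs).restrict Ω

theorem integrable_left {Ω : Set E} (p : L2Pair Ω) {η : E → ℝ} (h : IsTestFunction Ω η) (v : E) :
    Integrable (fun x => p.fst x * fderiv ℝ η x v) (volume.restrict Ω) :=
  (Lp.memLp p.fst).integrable_mul (h.memLp_fderiv v)

theorem integrable_right {Ω : Set E} (p : L2Pair Ω) {η : E → ℝ} (h : IsTestFunction Ω η) (v : E) :
    Integrable (fun x => inner ℝ (p.snd x) v * η x) (volume.restrict Ω) :=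
  ((Lp.memLp p.snd).inner_const v).integrable_mul h.memLp

/-- `H¹(Ω)`: square-integrable functions with a square-integrable weak gradient. -/
def H1 (Ω : Set E) : Submodule ℝ (L2Pair Ω) where
  carrier := {p | IsWeakGradient Ω p.fst p.snd}
  zero_mem' := by
    intro η _ v
    have h1 : ((0 : L2Pair Ω).fst : E → ℝ) =ᵐ[volume.restrict Ω] 0 := Lp.coeFn_zero ..
    have h2 : ((0 : L2Pair Ω).snd : E → E) =ᵐ[volume.restrict Ω] 0 := Lp.coeFn_zero ..
    rw [integral_eq_zero_of_ae, integral_eq_zero_of_ae, neg_zero]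
    · filter_upwards [h2] with x hx
      rw [hx, Pi.zero_apply, inner_zero_left, zero_mul]; rfl
    · filter_upwards [h1] with x hx
      rw [hx, Pi.zero_apply, zero_mul]
  add_mem' := by
    intro p q hp hq η hη v
    have e1 : ∫ x in Ω, (p + q).fst x * fderiv ℝ η x v
        = ∫ x in Ω, (p.fst x * fderiv ℝ η x v + q.fst x * fderiv ℝ η x v) := by
      refine integral_congr_ae ?_
      filter_upwards [Lp.coeFn_add p.fst q.fst] with x hx
      simp only [WithLp.add_fst, hx, Pi.add_apply]
      ring
    have e2 : ∫ x in Ω, inner ℝ ((p + q).snd x) v * η x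
        = ∫ x in Ω, (inner ℝ (p.snd x) v * η x + inner ℝ (q.snd x) v * η x) := by
      refine integral_congr_ae ?_
      filter_upwards [Lp.coeFn_add p.snd q.snd] with x hx
      simp only [WithLp.add_snd, hx, Pi.add_apply, inner_add_left]
      ring
    rw [e1, e2, integral_add (integrable_left p hη v) (integrable_left q hη v),
      integral_add (integrable_right p hη v) (integrable_right q hη v), hp η hη v, hq η hη v]
    ring
  smul_mem' := by
    intro c p hp η hη v
    have e1 : ∫ x in Ω, (c • p).fst x * fderiv ℝ η x v
        = ∫ x in Ω, c * (p.fst x * fderiv ℝ η x v) := by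
      refine integral_congr_ae ?_
      filter_upwards [Lp.coeFn_smul c p.fst] with x hx
      simp only [WithLp.smul_fst, hx, Pi.smul_apply, smul_eq_mul]
      ring
    have e2 : ∫ x in Ω, inner ℝ ((c • p).snd x) v * η x
        = ∫ x in Ω, c * (inner ℝ (p.snd x) v * η x) := by
      refine integral_congr_ae ?_
      filter_upwards [Lp.coeFn_smul c p.snd] with x hx
      simp only [WithLp.smul_snd, hx, Pi.smul_apply, real_inner_smul_left]
      ring
    rw [e1, e2, integral_const_mul, integral_const_mul, hp η hη v]
    ring

/-- `H¹₀(Ω)`: the closure in the `H¹`-norm of the (pairs `(η, ∇η)` of) test functions on `Ω`. -/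
def H10 [CompleteSpace E] (Ω : Set E) : Submodule ℝ (L2Pair Ω) :=
  (Submodule.span ℝ {p : L2Pair Ω | ∃ η : E → ℝ, IsTestFunction Ω η ∧
    p.fst =ᵐ[volume.restrict Ω] η ∧
    p.snd =ᵐ[volume.restrict Ω] (fun x => gradient η x)}).topologicalClosure

end Sobolev

/-! ### The continuum/wire spaces -/

/-- The Euclidean space `ℝ^d`. -/
abbrev Space (d : ℕ) := EuclideanSpace ℝ (Fin d)

variable {d : ℕ} {Ω : Set (Space d)} {L : ℝ}

/-- `U = H¹₀(Ω)`, the temperatures of the body. -/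
abbrev U (Ω : Set (Space d)) := H10 Ω

/-- `W = H¹(0, L)`, the temperatures of the wire. -/
abbrev W (L : ℝ) := H1 (Ioo 0 L)

/-- `V = U × W`. -/
abbrev V (Ω : Set (Space d)) (L : ℝ) := WithLp 2 (U Ω × W L)

/-- `Q = ℝ²` with the Euclidean norm, the space of multipliers. -/
abbrev Q := EuclideanSpace ℝ (Fin 2)

/-- The body temperature `φ` of `v = (φ, θ)`. -/
def bodyTemp (v : V Ω L) : L2 Ω ℝ := v.fst.1.fst

/-- The weak gradient `∇φ` of `v = (φ, θ)`. -/
def bodyGrad (v : V Ω L) : L2 Ω (Space d) := v.fst.1.snd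

/-- The wire temperature `θ` of `v = (φ, θ)`. -/
def wireTemp (v : V Ω L) : L2 (Ioo 0 L) ℝ := v.snd.1.fst

/-- The weak derivative `θ'` of `v = (φ, θ)`. -/
def wireDeriv (v : V Ω L) : L2 (Ioo 0 L) ℝ := v.snd.1.snd

/-- The norm of `V`:
`‖(φ,θ)‖² = ‖φ‖² + ℓ² ‖∇φ‖² + ℓ^(d-1) (‖θ‖² + L² ‖θ'‖²)`, with `L²`-norms on the right. -/
def normV (ℓ : ℝ) (v : V Ω L) : ℝ :=
  Real.sqrt ((‖bodyTemp v‖ ^ 2 + ℓ ^ 2 * ‖bodyGrad v‖ ^ 2)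
    + ℓ ^ (d - 1) * (‖wireTemp v‖ ^ 2 + L ^ 2 * ‖wireDeriv v‖ ^ 2))

open Classical in
/-- The continuous representative on `[0, L]` of a class of functions on `(0, L)`
(every class in `H¹(0, L)` has one; classes without one get the value `0`). -/
def contRep (L : ℝ) (θ : L2 (Ioo 0 L) ℝ) : ℝ → ℝ :=
  if h : ∃ g : ℝ → ℝ, ContinuousOn g (Icc 0 L) ∧ θ =ᵐ[volume.restrict (Ioo 0 L)] g
  then h.choose else 0

/-- The continuous representative is unique on `[0, L]`. -/
theorem contRep_eqOn (hL : 0 < L) (θ : L2 (Ioo 0 L) ℝ) (g : ℝ → ℝ)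
    (hg : ContinuousOn g (Icc 0 L)) (hθ : θ =ᵐ[volume.restrict (Ioo 0 L)] g) :
    EqOn (contRep L θ) g (Icc 0 L) := by
  have h : ∃ g : ℝ → ℝ, ContinuousOn g (Icc 0 L) ∧ θ =ᵐ[volume.restrict (Ioo 0 L)] g :=
    ⟨g, hg, hθ⟩
  have e : contRep L θ = h.choose := dif_pos h
  rw [e]
  refine Measure.eqOn_Icc_of_ae_eq volume hL.ne ?_ h.choose_spec.1 hg
  rw [restrict_Ioo_eq_restrict_Icc.symm]
  exact h.choose_spec.2.symm.trans hθ

/-- The mean `(1/|B|) ∫_B φ`. -/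
def mean (B : Set (Space d)) (φ : L2 Ω ℝ) : ℝ := 1 / volume.real B * ∫ x in B, φ x

/-- `a(φ,θ; ψ,δ) = ∫_Ω κ ∇φ · ∇ψ + ∫_0^L κb θ' δ'`. -/
def formA (κ κb : ℝ) (u v : V Ω L) : ℝ :=
  (∫ x in Ω, κ * inner ℝ (bodyGrad u x) (bodyGrad v x))
    + ∫ x in Ioo 0 L, κb * (wireDeriv u x * wireDeriv v x)

/-- `b(φ,θ; Γ) = Γ₁ (θ(0) - mean of φ on B₁) + Γ₂ (θ(L) - mean of φ on B₂)`. -/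
def formB (B₁ B₂ : Set (Space d)) (v : V Ω L) (Γ : Q) : ℝ :=
  Γ 0 * (contRep L (wireTemp v) 0 - mean B₁ (bodyTemp v))
    + Γ 1 * (contRep L (wireTemp v) L - mean B₂ (bodyTemp v))

/-! ### The mixed problem on a subspace -/

/-- `(u, lam)` solves the mixed problem on the subspace `Vh` of `V`, with multipliers in `Q`:
`a(u,v) + b(v,lam) = F(v)` for `v ∈ Vh`, and `b(u,Γ) = 0` for `Γ ∈ Q`.
For `Vh = ⊤` this is the continuous problem. -/
def IsMixedSolution (κ κb : ℝ) (B₁ B₂ : Set (Space d)) (F : V Ω L →L[ℝ] ℝ)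
    (Vh : Submodule ℝ (V Ω L)) (u : V Ω L) (lam : Q) : Prop :=
  u ∈ Vh ∧ (∀ v ∈ Vh, formA κ κb u v + formB B₁ B₂ v lam = F v)
    ∧ ∀ Γ : Q, formB B₁ B₂ u Γ = 0

/-- The kernel of the operator `B : V → Q'`. -/
def kerB (Ω : Set (Space d)) (L : ℝ) (B₁ B₂ : Set (Space d)) : Set (V Ω L) :=
  {v | ∀ Γ : Q, formB B₁ B₂ v Γ = 0}

/-- The kernel of the discrete operator `B_h : Vh → Q'`. -/
def kerBh (B₁ B₂ : Set (Space d)) (Vh : Submodule ℝ (V Ω L)) : Set (V Ω L) :=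
  {v | v ∈ Vh ∧ ∀ Γ : Q, formB B₁ B₂ v Γ = 0}

/-- The kernel of the transpose `B_hᵀ : Q → Vh'`. -/
def kerBhT (B₁ B₂ : Set (Space d)) (Vh : Submodule ℝ (V Ω L)) : Set Q :=
  {Γ | ∀ v ∈ Vh, formB B₁ B₂ v Γ = 0}

/-- Surjectivity of `B_h : Vh → Q'`, where `Q'` is identified with `Q` by the inner product. -/
def BhSurjective (B₁ B₂ : Set (Space d)) (Vh : Submodule ℝ (V Ω L)) : Prop :=
  ∀ q : Q, ∃ v ∈ Vh, ∀ Γ : Q, formB B₁ B₂ v Γ = inner ℝ q Γ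

/-- The norm of the class of `Γ` in the quotient `Q / ker B_hᵀ`. -/
def quotNorm (B₁ B₂ : Set (Space d)) (Vh : Submodule ℝ (V Ω L)) (Γ : Q) : ℝ :=
  Metric.infDist Γ (kerBhT B₁ B₂ Vh)

/-- The inf-sup condition on `Vh` with constant `β`:
`sup_{v ∈ Vh} b(v,Γ)/‖v‖_V ≥ β ‖Γ‖_{Q / ker B_hᵀ}` for all `Γ ∈ Q` (the quotient is `0` at
`v = 0`). -/
def InfSup (ℓ : ℝ) (B₁ B₂ : Set (Space d)) (Vh : Submodule ℝ (V Ω L)) (β : ℝ) : Prop :=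
  ∀ Γ : Q, β * quotNorm B₁ B₂ Vh Γ ≤ ⨆ v : Vh, formB B₁ B₂ v.1 Γ / normV ℓ v.1

/-- `Vh` contains all pairs `(0, θ)` with `θ` affine on `(0, L)`. -/
def ContainsAffineWire (Vh : Submodule ℝ (V Ω L)) : Prop :=
  ∀ v : V Ω L, v.fst = 0 →
    (∃ p q : ℝ, wireTemp v =ᵐ[volume.restrict (Ioo 0 L)] fun x => p + q * x) → v ∈ Vh

/-- The error of best approximation, `inf_{v ∈ Vh} ‖u - v‖_V`. -/
def bestApprox (ℓ : ℝ) (Vh : Submodule ℝ (V Ω L)) (u : V Ω L) : ℝ :=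
  ⨅ v : Vh, normV ℓ (u - v.1)

end LinkedWire

end

/-!
The mixed problem is a saddle-point problem on the Hilbert space `V` with two scalar constraints,
and everything follows from three facts about the concrete forms.

* `formA` and `formB` are continuous. For the end values `θ(0)`, `θ(L)` this is the trace inequality
  in `H¹(0, L)`: by the lemma of du Bois-Reymond every `θ` is a constant plus the primitive of its
  weak derivative (`exists_eq_const_add_primitive`), which gives the continuous representative and
  its bounds in terms of `θ` and `θ'`.
* `formA` is coercive on the kernel of the constraints (`exists_coercive`): the Poincaré inequality
  (`poincare_H10`) bounds `φ` by `∇φ`, the constraint at `0` then bounds `θ(0)`, and `θ(0)` and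
  `θ'` bound `θ`. Since the multipliers range over all of `Q`, the discrete kernel lies in the
  continuous one, and coercivity holds on every subspace with the same constant.
* The constraint operator has finite-dimensional range, so that on every subspace it has a bounded
  right inverse onto its range; this is an inf-sup condition (`isInfSup_of_lifting`,
  `exists_isInfSup`). If the subspace contains the affine wire temperatures, they provide a right
  inverse whose bound does not depend on the subspace (`exists_uniform_lifting`).

On a closed subspace `S`, Lax-Milgram on the kernel gives the primal solution, and the residual
vanishes on the kernel of finitely many functionals, so it is represented by a multiplier
(`exists_saddle_point`). For quasi-optimality an arbitrary `v ∈ S` is corrected to an element of the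
discrete kernel by removing its component `r` orthogonal to that kernel: `r` is represented by a
multiplier `y`, so that `‖r‖² = b(r, y) = b(v - u, y)`, and the inf-sup condition bounds `y` by `r`
(`exists_kernel_correction`).
-/

noncomputable section

namespace LinkedWire


/-! ### Abstract saddle-point problems with finitely many constraints -/

section Saddle

variable {X Y : Type*} [NormedAddCommGroup X] [InnerProductSpace ℝ X]
  [NormedAddCommGroup Y] [InnerProductSpace ℝ Y]

/-- The inf-sup condition with constant `β` for the constraint operator `b` on the subspace `S`,
where `N` measures the size of elements of `X`. The kernel of the transpose of `b` restricted to
`S` is the orthogonal complement of `b(S)`. -/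
def IsInfSup (b : X →L[ℝ] Y) (N : X → ℝ) (S : Submodule ℝ X) (β : ℝ) : Prop :=
  ∀ y : Y, β * Metric.infDist y ((S.map (b : X →ₗ[ℝ] Y))ᗮ : Submodule ℝ Y)
    ≤ ⨆ v : S, inner ℝ (b v) y / N v

variable {a : X →L[ℝ] X →L[ℝ] ℝ} {b : X →L[ℝ] Y} {N : X → ℝ} {c₁ c₂ α β : ℝ}
  {S : Submodule ℝ X}

theorem mem_orthogonal_map_iff {y : Y} :
    y ∈ (S.map (b : X →ₗ[ℝ] Y))ᗮ ↔ ∀ v ∈ S, inner ℝ (b v) y = 0 := by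
  simp [Submodule.mem_orthogonal]

/-- A functional on `S` that vanishes on the kernel of `b` factors through `b`. -/
theorem exists_multiplier [FiniteDimensional ℝ Y] (g : X →L[ℝ] ℝ)
    (hg : ∀ v ∈ S, b v = 0 → g v = 0) :
    ∃ y : Y, ∀ v ∈ S, g v = inner ℝ (b v) y := by
  have h : (g : X →ₗ[ℝ] ℝ).domRestrict S ∈
      LinearMap.range ((b : X →ₗ[ℝ] Y).domRestrict S).dualMap := by
    rw [LinearMap.range_dualMap_eq_dualAnnihilator_ker, Submodule.mem_dualAnnihilator]
    intro v hv
    exact hg v v.2 (by simpa using hv)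
  obtain ⟨k, hk⟩ := h
  have : CompleteSpace Y := FiniteDimensional.complete ℝ Y
  refine ⟨(InnerProductSpace.toDual ℝ Y).symm (LinearMap.toContinuousLinearMap k), ?_⟩
  intro v hv
  rw [real_inner_comm, InnerProductSpace.toDual_symm_apply]
  exact (LinearMap.congr_fun hk ⟨v, hv⟩).symm

theorem isClosed_inf_ker (hS : IsClosed (S : Set X)) :
    IsClosed ((S ⊓ LinearMap.ker (b : X →ₗ[ℝ] Y) : Submodule ℝ X) : Set X) :=
  hS.inter b.isClosed_ker

theorem exists_saddle_point [CompleteSpace X] [FiniteDimensional ℝ Y] (hα : 0 < α)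
    (ha : ∀ v, b v = 0 → α * ‖v‖ ^ 2 ≤ a v v) (hS : IsClosed (S : Set X)) (F : X →L[ℝ] ℝ) :
    ∃ u ∈ S, b u = 0 ∧ ∃ y : Y, ∀ v ∈ S, a u v + inner ℝ (b v) y = F v := by
  set K : Submodule ℝ X := S ⊓ LinearMap.ker (b : X →ₗ[ℝ] Y) with hK
  have : CompleteSpace K := (isClosed_inf_ker hS).completeSpace_coe
  let aK : K →L[ℝ] K →L[ℝ] ℝ := a.bilinearComp K.subtypeL K.subtypeL
  have hco : IsCoercive aK := by
    refine ⟨α, hα, fun v => ?_⟩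
    have := ha v (by simpa using v.2.2)
    simpa [aK, pow_two, mul_assoc] using this
  let f : K := (InnerProductSpace.toDual ℝ K).symm (F.comp K.subtypeL)
  let u : K := hco.continuousLinearEquivOfBilin.symm f
  have hu : ∀ w ∈ K, a u w = F w := by
    intro w hw
    have h1 := hco.continuousLinearEquivOfBilin_apply u ⟨w, hw⟩
    rw [ContinuousLinearEquiv.apply_symm_apply, InnerProductSpace.toDual_symm_apply] at h1
    simpa [aK] using h1.symm
  obtain ⟨y, hy⟩ := exists_multiplier (b := b) (S := S) (F - a u) (fun v hv hbv => by
    simp [hu v ⟨hv, by simpa using hbv⟩])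
  refine ⟨u, u.2.1, by simpa using u.2.2, y, fun v hv => ?_⟩
  rw [← hy v hv]
  simp

theorem saddle_point_unique (hα : 0 < α) (ha : ∀ v, b v = 0 → α * ‖v‖ ^ 2 ≤ a v v)
    {F : X →L[ℝ] ℝ} {u u' : X} {y y' : Y} (hu : u ∈ S) (hu' : u' ∈ S)
    (hbu : b u = 0) (hbu' : b u' = 0) (h : ∀ v ∈ S, a u v + inner ℝ (b v) y = F v)
    (h' : ∀ v ∈ S, a u' v + inner ℝ (b v) y' = F v) :
    u = u' ∧ y - y' ∈ (S.map (b : X →ₗ[ℝ] Y))ᗮ := by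
  have hb : b (u - u') = 0 := by rw [map_sub, hbu, hbu', sub_zero]
  have e : u = u' := by
    have h1 := h _ (S.sub_mem hu hu')
    have h2 := h' _ (S.sub_mem hu hu')
    rw [hb, inner_zero_left, add_zero] at h1 h2
    have h3 := ha _ hb
    have h4 : a (u - u') (u - u') = 0 := by
      rw [map_sub a, sub_apply, h1, h2, sub_self]
    rw [h4] at h3
    have h5 : ‖u - u'‖ ^ 2 ≤ 0 := nonpos_of_mul_nonpos_right h3 hα
    have h6 : ‖u - u'‖ = 0 := by
      simpa using le_antisymm h5 (sq_nonneg _)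
    exact sub_eq_zero.1 (norm_eq_zero.1 h6)
  refine ⟨e, mem_orthogonal_map_iff.2 fun v hv => ?_⟩
  subst e
  rw [inner_sub_right]
  linarith [h v hv, h' v hv]

/-! ### The inf-sup condition -/

/-- The upper bounds that the inf-sup condition gives for the distance of a multiplier to the
kernel of the transpose. -/
theorem IsInfSup.mul_infDist_le (h : IsInfSup b N S β) (hN : ∀ v, 0 ≤ N v) {y : Y} {M : ℝ}
    (hM : 0 ≤ M) (hy : ∀ v ∈ S, inner ℝ (b v) y ≤ M * N v) :
    β * Metric.infDist y ((S.map (b : X →ₗ[ℝ] Y))ᗮ : Submodule ℝ Y) ≤ M :=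
  (h y).trans (ciSup_le fun v => div_le_of_le_mul₀ (hN v) hM (hy v v.2))

/-- A right inverse of `b : S → b(S)` with bound `E` gives the inf-sup condition with constant
`E⁻¹`: test with the lifting of the orthogonal projection of the multiplier to `b(S)`. -/
theorem isInfSup_of_lifting [FiniteDimensional ℝ Y] (hc₁ : 0 < c₁)
    (hN₁ : ∀ v, c₁ * ‖v‖ ≤ N v) {E : ℝ} (hE : 0 < E)
    (hl : ∀ z ∈ S.map (b : X →ₗ[ℝ] Y), ∃ v ∈ S, b v = z ∧ N v ≤ E * ‖z‖) :
    IsInfSup b N S E⁻¹ := by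
  intro y
  have hN : ∀ v, 0 ≤ N v := fun v => (by positivity : 0 ≤ c₁ * ‖v‖).trans (hN₁ v)
  have hbdd : BddAbove (range fun v : S => inner ℝ (b v) y / N v) := by
    refine ⟨‖b‖ * ‖y‖ / c₁, ?_⟩
    rintro _ ⟨v, rfl⟩
    refine div_le_of_le_mul₀ (hN v) (by positivity) ?_
    calc inner ℝ (b v) y ≤ ‖b v‖ * ‖y‖ := real_inner_le_norm _ _
      _ ≤ ‖b‖ * ‖(v : X)‖ * ‖y‖ := by gcongr; exact b.le_opNorm v
      _ = ‖b‖ * ‖y‖ / c₁ * (c₁ * ‖(v : X)‖) := by field_simp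
      _ ≤ _ := by gcongr; exact hN₁ v
  set R := S.map (b : X →ₗ[ℝ] Y)
  let z : Y := R.starProjection y
  have hz : z ∈ R := R.starProjection_apply_mem y
  have hyz : y - z ∈ Rᗮ := R.sub_starProjection_mem_orthogonal y
  have h1 : Metric.infDist y (Rᗮ : Submodule ℝ Y) ≤ ‖z‖ := by
    refine (Metric.infDist_le_dist_of_mem hyz).trans (le_of_eq ?_)
    rw [dist_eq_norm, sub_sub_cancel]
  obtain ⟨v, hv, hbv, hNv⟩ := hl z hz
  have h2 : inner ℝ (b v) y = ‖z‖ ^ 2 := by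
    have : inner ℝ z (y - z) = 0 := (Submodule.mem_orthogonal _ _).1 hyz z hz
    rw [inner_sub_right, real_inner_self_eq_norm_sq] at this
    rw [hbv]; linarith
  refine le_trans ?_ (le_ciSup hbdd ⟨v, hv⟩)
  rw [inv_mul_le_iff₀ hE]
  refine h1.trans ?_
  simp only [h2]
  rcases eq_or_ne z 0 with h0 | h0
  · simp [h0]
  have hzpos : 0 < ‖z‖ := norm_pos_iff.2 h0
  have hNpos : 0 < N v := by
    refine lt_of_lt_of_le (mul_pos hc₁ (norm_pos_iff.2 ?_)) (hN₁ v)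
    rintro rfl
    exact h0 (by rw [← hbv, map_zero])
  rw [← mul_div_assoc, le_div_iff₀ hNpos]
  nlinarith

theorem exists_isInfSup [FiniteDimensional ℝ Y] (hc₁ : 0 < c₁)
    (hN₁ : ∀ v, c₁ * ‖v‖ ≤ N v) (hc₂ : 0 < c₂) (hN₂ : ∀ v, N v ≤ c₂ * ‖v‖) :
    ∃ β > 0, IsInfSup b N S β := by
  set R := S.map (b : X →ₗ[ℝ] Y) with hR
  let bS : S →ₗ[ℝ] R := (b : X →ₗ[ℝ] Y).submoduleMap S
  obtain ⟨e, he⟩ := bS.exists_rightInverse_of_surjective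
    (LinearMap.range_eq_top.2 ((b : X →ₗ[ℝ] Y).submoduleMap_surjective S))
  let e' : R →L[ℝ] S := LinearMap.toContinuousLinearMap e
  have hE : 0 < c₂ * (‖e'‖ + 1) := by positivity
  refine ⟨_, inv_pos.2 hE, isInfSup_of_lifting hc₁ hN₁ hE fun z hz => ?_⟩
  refine ⟨e' ⟨z, hz⟩, (e' ⟨z, hz⟩).2, ?_, ?_⟩
  · have := LinearMap.congr_fun he ⟨z, hz⟩
    exact congrArg Subtype.val this
  · refine (hN₂ _).trans ?_
    have h1 : ‖((e' ⟨z, hz⟩ : S) : X)‖ ≤ ‖e'‖ * ‖z‖ := e'.le_opNorm ⟨z, hz⟩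
    rw [mul_assoc]
    gcongr
    refine h1.trans ?_
    gcongr
    linarith

/-! ### Stability and quasi-optimality -/

/-- The stability estimate, for a coercivity constant with respect to `N`. -/
theorem saddle_point_stability (hα : 0 < α) (ha : ∀ v, b v = 0 → α * N v ^ 2 ≤ a v v)
    (hc₁ : 0 < c₁) (hN₁ : ∀ v, c₁ * ‖v‖ ≤ N v) (hβ : 0 < β) (h : IsInfSup b N S β)
    {F : X →L[ℝ] ℝ} {u : X} {y : Y} (hu : u ∈ S) (hbu : b u = 0)
    (hs : ∀ v ∈ S, a u v + inner ℝ (b v) y = F v) {M : ℝ} (hM : 0 ≤ M)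
    (hF : ∀ v ∈ S, |F v| ≤ M * N v) :
    N u + Metric.infDist y ((S.map (b : X →ₗ[ℝ] Y))ᗮ : Submodule ℝ Y)
      ≤ (1 / α + (1 + ‖a‖ / c₁ ^ 2 / α) / β) * M := by
  have hN : ∀ v, 0 ≤ N v := fun v => (by positivity : 0 ≤ c₁ * ‖v‖).trans (hN₁ v)
  have hn : ∀ v, ‖v‖ ≤ N v / c₁ := fun v => by
    rw [le_div_iff₀ hc₁, mul_comm]; exact hN₁ v
  have h1 : N u ≤ M / α := by
    have h2 := ha u hbu
    have h3 := hs u hu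
    rw [hbu, inner_zero_left, add_zero] at h3
    have h4 : α * N u ^ 2 ≤ M * N u := by
      rw [h3] at h2
      exact h2.trans ((le_abs_self _).trans (hF u hu))
    rcases (hN u).eq_or_lt with h0 | h0
    · rw [← h0]; positivity
    · rw [le_div_iff₀ hα]
      nlinarith
  have h2 : β * Metric.infDist y ((S.map (b : X →ₗ[ℝ] Y))ᗮ : Submodule ℝ Y)
      ≤ (1 + ‖a‖ / c₁ ^ 2 / α) * M := by
    refine h.mul_infDist_le hN (by positivity) fun v hv => ?_
    have h3 : |a u v| ≤ ‖a‖ * (N u / c₁) * (N v / c₁) := by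
      rw [← Real.norm_eq_abs]
      refine (a.le_opNorm₂ u v).trans ?_
      gcongr
      · have := hN u
        positivity
      · exact hn u
      · exact hn v
    have h4 : ‖a‖ * (N u / c₁) * (N v / c₁) ≤ ‖a‖ * (M / α / c₁) * (N v / c₁) := by
      have := hN v
      gcongr
    have h5 := hs v hv
    have h6 := (le_abs_self _).trans (hF v hv)
    have h7 := neg_abs_le (a u v)
    have h8 : (1 + ‖a‖ / c₁ ^ 2 / α) * M * N v
        = M * N v + ‖a‖ * (M / α / c₁) * (N v / c₁) := by field_simp
    rw [h8]
    linarith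
  rw [mul_comm, ← le_div_iff₀ hβ] at h2
  calc _ ≤ M / α + (1 + ‖a‖ / c₁ ^ 2 / α) * M / β := add_le_add h1 h2
    _ = _ := by ring

/-- Correction to the kernel: the part `r` of `v ∈ S` orthogonal to `S ∩ ker b` is controlled by
`‖v - u‖` for every `u ∈ ker b`. The functional `⟪r, ·⟫` on `S` vanishes on the kernel of `b`,
so it is given by a multiplier, whose size the inf-sup condition bounds by that of `r`. -/
theorem exists_kernel_correction [CompleteSpace X] [FiniteDimensional ℝ Y]
    (hc₁ : 0 < c₁) (hN₁ : ∀ v, c₁ * ‖v‖ ≤ N v) (hβ : 0 < β) (h : IsInfSup b N S β)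
    (hS : IsClosed (S : Set X)) {u v : X} (hu : b u = 0) (hv : v ∈ S) :
    ∃ w ∈ S, b w = 0 ∧ ‖v - w‖ ≤ ‖b‖ / (c₁ * β) * ‖u - v‖ := by
  have hN : ∀ v, 0 ≤ N v := fun v => (by positivity : 0 ≤ c₁ * ‖v‖).trans (hN₁ v)
  set K : Submodule ℝ X := S ⊓ LinearMap.ker (b : X →ₗ[ℝ] Y) with hK
  have : CompleteSpace K := (isClosed_inf_ker hS).completeSpace_coe
  let w : X := K.starProjection v
  have hw : w ∈ K := K.starProjection_apply_mem v
  have hbw : b w = 0 := by simpa using hw.2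
  set r := v - w with hr
  have hrK : r ∈ Kᗮ := K.sub_starProjection_mem_orthogonal v
  have hrS : r ∈ S := S.sub_mem hv hw.1
  obtain ⟨y, hy⟩ := exists_multiplier (b := b) (S := S) (innerSL ℝ r) (fun x hx hbx => by
    have := (Submodule.mem_orthogonal _ _).1 hrK x ⟨hx, by simpa using hbx⟩
    rwa [real_inner_comm] at this)
  simp only [innerSL_apply_apply] at hy
  refine ⟨w, hw.1, hbw, ?_⟩
  set R := S.map (b : X →ₗ[ℝ] Y) with hR
  have h1 : β * Metric.infDist y (Rᗮ : Submodule ℝ Y) ≤ ‖r‖ / c₁ := by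
    refine h.mul_infDist_le hN (by positivity) fun x hx => ?_
    rw [← hy x hx]
    calc inner ℝ r x ≤ ‖r‖ * ‖x‖ := real_inner_le_norm _ _
      _ = ‖r‖ / c₁ * (c₁ * ‖x‖) := by field_simp
      _ ≤ _ := by gcongr; exact hN₁ x
  have h2 : ‖r‖ ^ 2 ≤ ‖b‖ * ‖u - v‖ * Metric.infDist y (Rᗮ : Submodule ℝ Y) := by
    obtain ⟨k, hk, hyk⟩ := (Rᗮ.closed_of_finiteDimensional).exists_infDist_eq_dist
      ⟨0, Rᗮ.zero_mem⟩ y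
    have hbr : b r = b (v - u) := by rw [hr, map_sub, map_sub, hbw, hu]
    have h3 : inner ℝ (b r) k = 0 := mem_orthogonal_map_iff.1 hk r hrS
    calc ‖r‖ ^ 2 = inner ℝ (b r) (y - k) := by
          rw [← real_inner_self_eq_norm_sq, hy r hrS, inner_sub_right, h3, sub_zero]
      _ ≤ ‖b r‖ * ‖y - k‖ := real_inner_le_norm _ _
      _ ≤ ‖b‖ * ‖u - v‖ * ‖y - k‖ := by
          gcongr
          rw [hbr, norm_sub_rev u v]
          exact b.le_opNorm _
      _ = _ := by rw [hyk, dist_eq_norm]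
  have h4 : ‖r‖ ^ 2 ≤ ‖b‖ / (c₁ * β) * ‖u - v‖ * ‖r‖ := by
    refine h2.trans ?_
    calc _ = ‖b‖ * ‖u - v‖ / β * (β * Metric.infDist y (Rᗮ : Submodule ℝ Y)) := by
          field_simp
      _ ≤ ‖b‖ * ‖u - v‖ / β * (‖r‖ / c₁) := by gcongr
      _ = _ := by field_simp
  rcases (norm_nonneg r).eq_or_lt with h0 | h0
  · rw [← h0]; positivity
  · nlinarith

/-- The constant of the quasi-optimality estimate, as a function of the inf-sup constant `β`. -/
def quasiOptConst (a : X →L[ℝ] X →L[ℝ] ℝ) (b : X →L[ℝ] Y) (c₁ c₂ α β : ℝ) : ℝ :=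
  (c₂ + ‖a‖ / (c₁ * β)) * ((1 + ‖a‖ / α) * (1 + ‖b‖ / (c₁ * β))) / c₁

theorem quasiOptConst_pos (hα : 0 < α) (hc₁ : 0 < c₁) (hc₂ : 0 < c₂) (hβ : 0 < β) :
    0 < quasiOptConst a b c₁ c₂ α β := by
  unfold quasiOptConst
  positivity

/-- Quasi-optimality: a solution of the problem on `S` compared with any `(u, y)` that satisfies
the constraint and the same equations tested with `S`. -/
theorem saddle_point_quasi_optimal [CompleteSpace X] [FiniteDimensional ℝ Y]
    (hα : 0 < α) (ha : ∀ v, b v = 0 → α * ‖v‖ ^ 2 ≤ a v v)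
    (hc₁ : 0 < c₁) (hN₁ : ∀ v, c₁ * ‖v‖ ≤ N v) (hc₂ : 0 < c₂) (hN₂ : ∀ v, N v ≤ c₂ * ‖v‖)
    (hβ : 0 < β) (h : IsInfSup b N S β) (hS : IsClosed (S : Set X))
    {F : X →L[ℝ] ℝ} {u uh : X} {y yh : Y} (huh : uh ∈ S) (hbuh : b uh = 0)
    (hsh : ∀ v ∈ S, a uh v + inner ℝ (b v) yh = F v) (hbu : b u = 0)
    (hs : ∀ v ∈ S, a u v + inner ℝ (b v) y = F v) :
    N (u - uh) + Metric.infDist (y - yh) ((S.map (b : X →ₗ[ℝ] Y))ᗮ : Submodule ℝ Y)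
      ≤ quasiOptConst a b c₁ c₂ α β * ⨅ v : S, N (u - v) := by
  have hN : ∀ v, 0 ≤ N v := fun v => (by positivity : 0 ≤ c₁ * ‖v‖).trans (hN₁ v)
  have hC := quasiOptConst_pos (a := a) (b := b) hα hc₁ hc₂ hβ
  rw [mul_comm, ← div_le_iff₀ hC]
  refine le_ciInf fun v => ?_
  rw [div_le_iff₀ hC]
  obtain ⟨w, hwS, hbw, hw⟩ := exists_kernel_correction hc₁ hN₁ hβ h hS hbu v.2
  have h1 : ‖u - w‖ ≤ (1 + ‖b‖ / (c₁ * β)) * ‖u - v‖ := by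
    have := norm_sub_le_norm_sub_add_norm_sub u (v : X) w
    linarith
  have h2 : ‖uh - w‖ ≤ ‖a‖ / α * ‖u - w‖ := by
    have hb : b (uh - w) = 0 := by rw [map_sub, hbuh, hbw, sub_zero]
    have h3 := ha _ hb
    have h4 := hs _ (S.sub_mem huh hwS)
    have h5 := hsh _ (S.sub_mem huh hwS)
    rw [hb, inner_zero_left, add_zero] at h4 h5
    have h6 : a (uh - w) (uh - w) = a (u - w) (uh - w) := by
      rw [map_sub a, map_sub a, sub_apply, sub_apply, h4, h5]
    rw [h6] at h3
    have h7 := h3.trans ((le_abs_self _).trans (a.le_opNorm₂ (u - w) (uh - w)))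
    rcases (norm_nonneg (uh - w)).eq_or_lt with h0 | h0
    · rw [← h0]; positivity
    · rw [div_mul_eq_mul_div, le_div_iff₀ hα]
      nlinarith
  have h3 : ‖u - uh‖ ≤ (1 + ‖a‖ / α) * (1 + ‖b‖ / (c₁ * β)) * ‖u - v‖ := by
    have h4 := norm_sub_le_norm_sub_add_norm_sub u w uh
    rw [norm_sub_rev w uh] at h4
    calc ‖u - uh‖ ≤ (1 + ‖a‖ / α) * ‖u - w‖ := by linarith
      _ ≤ (1 + ‖a‖ / α) * ((1 + ‖b‖ / (c₁ * β)) * ‖u - v‖) := by gcongr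
      _ = _ := by ring
  have h4 : β * Metric.infDist (y - yh) ((S.map (b : X →ₗ[ℝ] Y))ᗮ : Submodule ℝ Y)
      ≤ ‖a‖ * ‖u - uh‖ / c₁ := by
    refine h.mul_infDist_le hN (by positivity) fun x hx => ?_
    have h5 : inner ℝ (b x) (y - yh) = a (uh - u) x := by
      rw [inner_sub_right, map_sub a, sub_apply]
      linarith [hs x hx, hsh x hx]
    rw [h5]
    refine ((le_abs_self _).trans (a.le_opNorm₂ (uh - u) x)).trans ?_
    rw [norm_sub_rev]
    calc ‖a‖ * ‖u - uh‖ * ‖x‖ = ‖a‖ * ‖u - uh‖ / c₁ * (c₁ * ‖x‖) := by field_simp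
      _ ≤ _ := by gcongr; exact hN₁ x
  rw [mul_comm, ← le_div_iff₀ hβ] at h4
  calc _ ≤ c₂ * ‖u - uh‖ + ‖a‖ * ‖u - uh‖ / c₁ / β := add_le_add (hN₂ _) h4
    _ = (c₂ + ‖a‖ / (c₁ * β)) * ‖u - uh‖ := by field_simp
    _ ≤ (c₂ + ‖a‖ / (c₁ * β)) *
        ((1 + ‖a‖ / α) * (1 + ‖b‖ / (c₁ * β)) * (N (u - v) / c₁)) := by
      gcongr
      refine h3.trans ?_
      gcongr
      rw [le_div_iff₀ hc₁, mul_comm]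
      exact hN₁ _
    _ = quasiOptConst a b c₁ c₂ α β * N (u - v) := by unfold quasiOptConst; ring
    _ = _ := mul_comm _ _

/-- One constant, depending only on the inf-sup constant, for stability and quasi-optimality on
all closed subspaces. -/
theorem exists_saddle_point_const [CompleteSpace X] [FiniteDimensional ℝ Y]
    (hα : 0 < α) (ha : ∀ v, b v = 0 → α * ‖v‖ ^ 2 ≤ a v v)
    {α' : ℝ} (hα' : 0 < α') (ha' : ∀ v, b v = 0 → α' * N v ^ 2 ≤ a v v)
    (hc₁ : 0 < c₁) (hN₁ : ∀ v, c₁ * ‖v‖ ≤ N v) (hc₂ : 0 < c₂) (hN₂ : ∀ v, N v ≤ c₂ * ‖v‖) :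
    ∃ C : ℝ → ℝ, ∀ S : Submodule ℝ X, IsClosed (S : Set X) → ∀ β > 0, IsInfSup b N S β →
      ∀ (F : X →L[ℝ] ℝ) (uh : X) (yh : Y),
        (uh ∈ S ∧ (∀ v ∈ S, a uh v + inner ℝ (b v) yh = F v) ∧ b uh = 0) →
        (∀ M, 0 ≤ M → (∀ v ∈ S, |F v| ≤ M * N v) →
          N uh + Metric.infDist yh ((S.map (b : X →ₗ[ℝ] Y))ᗮ : Submodule ℝ Y) ≤ C β * M) ∧
        ∀ (u : X) (y : Y), (∀ v ∈ S, a u v + inner ℝ (b v) y = F v) → b u = 0 →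
          N (u - uh) + Metric.infDist (y - yh) ((S.map (b : X →ₗ[ℝ] Y))ᗮ : Submodule ℝ Y)
            ≤ C β * ⨅ v : S, N (u - v) := by
  have hN : ∀ v, 0 ≤ N v := fun v => (by positivity : 0 ≤ c₁ * ‖v‖).trans (hN₁ v)
  refine ⟨fun β => (1 / α' + (1 + ‖a‖ / c₁ ^ 2 / α') / β) + quasiOptConst a b c₁ c₂ α β, ?_⟩
  rintro S hS β hβ h F uh yh ⟨huh, hsh, hbuh⟩
  have hq := quasiOptConst_pos (a := a) (b := b) hα hc₁ hc₂ hβ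
  refine ⟨fun M hM hF => ?_, fun u y hs hbu => ?_⟩
  · refine (saddle_point_stability hα' ha' hc₁ hN₁ hβ h huh hbuh hsh hM hF).trans ?_
    exact mul_le_mul_of_nonneg_right (by linarith) hM
  · refine (saddle_point_quasi_optimal hα ha hc₁ hN₁ hc₂ hN₂ hβ h hS huh hbuh hsh hbu hs).trans ?_
    refine mul_le_mul_of_nonneg_right ?_ (Real.iInf_nonneg fun v => hN _)
    have : 0 ≤ 1 / α' + (1 + ‖a‖ / c₁ ^ 2 / α') / β := by positivity
    linarith

end Saddle


/-! ### Functionals on `L²` and closedness of `H¹` -/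

section General

section SetIntegral

variable {E : Type*} [MeasureSpace E]

/-- Integration over a set of finite measure, as a continuous functional on `L²(Ω)`. -/
def setIntegralL (Ω : Set E) {s : Set E} (hs : MeasurableSet s) (hv : volume s ≠ ⊤) :
    L2 Ω ℝ →L[ℝ] ℝ :=
  innerSL ℝ (indicatorConstLp 2 hs
    (ne_top_of_le_ne_top hv (Measure.restrict_apply_le Ω s)) (1 : ℝ))

theorem setIntegralL_apply {Ω s : Set E} (hs : MeasurableSet s) (hv : volume s ≠ ⊤) (hsΩ : s ⊆ Ω)
    (f : L2 Ω ℝ) : setIntegralL Ω hs hv f = ∫ x in s, f x := by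
  rw [setIntegralL, innerSL_apply_apply, L2.inner_indicatorConstLp_one,
    Measure.restrict_restrict hs, inter_eq_left.2 hsΩ]

theorem abs_setIntegral_le {Ω s : Set E} (hs : MeasurableSet s) (hv : volume s ≠ ⊤) (hsΩ : s ⊆ Ω)
    (f : L2 Ω ℝ) : |∫ x in s, f x| ≤ √(volume.real s) * ‖f‖ := by
  rw [← setIntegralL_apply hs hv hsΩ, setIntegralL, innerSL_apply_apply]
  refine (abs_real_inner_le_norm _ _).trans (le_of_eq ?_)
  rw [norm_indicatorConstLp (by simp) (by simp)]
  simp [Real.sqrt_eq_rpow, measureReal_restrict_apply hs, inter_eq_left.2 hsΩ]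

end SetIntegral

variable {E : Type*} [NormedAddCommGroup E] [InnerProductSpace ℝ E] [MeasureSpace E]

theorem isClosed_H1 [BorelSpace E] [IsFiniteMeasureOnCompacts (volume : Measure E)] (Ω : Set E) :
    IsClosed (H1 Ω : Set (L2Pair Ω)) := by
  have h : (H1 Ω : Set (L2Pair Ω)) = ⋂ (η : E → ℝ) (_ : IsTestFunction Ω η) (v : E),
      {p | ∫ x in Ω, p.fst x * fderiv ℝ η x v = - ∫ x in Ω, inner ℝ (p.snd x) v * η x} := by
    ext p
    simp only [mem_iInter]
    rfl
  rw [h]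
  refine isClosed_iInter fun η => isClosed_iInter fun hη => isClosed_iInter fun v => ?_
  have hm : MemLp (fun x => η x • v) 2 (volume.restrict Ω) :=
    ((hη.smooth.continuous.smul continuous_const).memLp_of_hasCompactSupport (μ := volume)
      hη.compact.smul_right).restrict Ω
  have e1 : ∀ p : L2Pair Ω, ∫ x in Ω, p.fst x * fderiv ℝ η x v
      = inner ℝ ((hη.memLp_fderiv v).toLp _) p.fst := by
    intro p
    rw [L2.inner_def]
    refine integral_congr_ae ?_
    filter_upwards [(hη.memLp_fderiv v).coeFn_toLp] with x hx
    simp [hx]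
  have e2 : ∀ p : L2Pair Ω, ∫ x in Ω, inner ℝ (p.snd x) v * η x
      = inner ℝ (hm.toLp _) p.snd := by
    intro p
    rw [L2.inner_def]
    refine integral_congr_ae ?_
    filter_upwards [hm.coeFn_toLp] with x hx
    simp [hx, real_inner_smul_left, real_inner_comm, mul_comm]
  simp only [e1, e2]
  refine isClosed_eq ?_ ?_ <;> fun_prop

end General

/-! ### Sobolev functions on an interval -/

section Interval

variable {L : ℝ}

theorem fderiv_apply_real (η : ℝ → ℝ) (x v : ℝ) : fderiv ℝ η x v = v * deriv η x := by
  rw [← smul_eq_mul, ← fderiv_apply_one_eq_deriv, ← map_smul, smul_eq_mul, mul_one]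

theorem isWeakGradient_real_iff {φ g : ℝ → ℝ} {Ω : Set ℝ} :
    IsWeakGradient Ω φ g ↔ ∀ η : ℝ → ℝ, IsTestFunction Ω η →
      ∫ x in Ω, φ x * deriv η x = - ∫ x in Ω, g x * η x := by
  constructor
  · intro h η hη
    simpa [fderiv_apply_real] using h η hη 1
  · intro h η hη v
    have e1 : ∀ x, φ x * fderiv ℝ η x v = v * (φ x * deriv η x) := fun x => by
      rw [fderiv_apply_real]; ring
    have e2 : ∀ x, inner ℝ (g x) v * η x = v * (g x * η x) := fun x => by
      rw [real_inner_comm]; simp [mul_comm, mul_left_comm]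
    simp only [e1, e2, integral_const_mul, h η hη]
    ring

theorem IsTestFunction.eq_zero_of_notMem {Ω : Set ℝ} {η : ℝ → ℝ} (h : IsTestFunction Ω η) {x : ℝ}
    (hx : x ∉ Ω) : η x = 0 :=
  image_eq_zero_of_notMem_tsupport fun hx' => hx (h.support hx')

theorem intervalIntegrable_of_L2 (hL : 0 < L) (g : L2 (Ioo 0 L) ℝ) :
    IntervalIntegrable g volume 0 L := by
  rw [intervalIntegrable_iff_integrableOn_Ioo_of_le hL.le]
  exact (Lp.memLp g).integrable (by norm_num)

/-- A primitive of an integrable function has that function as weak derivative. -/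
theorem isWeakGradient_primitive (hL : 0 < L) {g : ℝ → ℝ} (hg : IntervalIntegrable g volume 0 L)
    (c : ℝ) : IsWeakGradient (Ioo 0 L) (fun x => c + ∫ t in (0)..x, g t) g := by
  rw [isWeakGradient_real_iff]
  intro η hη
  have hη1 : ContDiff ℝ 1 η := hη.smooth.of_le (by simp)
  have hηac : AbsolutelyContinuousOnInterval η 0 L :=
    hη1.contDiffOn.absolutelyContinuousOnInterval
  have hJ : AbsolutelyContinuousOnInterval (fun x => ∫ t in (0)..x, g t) 0 L :=
    hg.absolutelyContinuousOnInterval_intervalIntegral (by simp)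
  have hc : AbsolutelyContinuousOnInterval (fun _ : ℝ => c) 0 L :=
    (contDiff_const (n := 1)).contDiffOn.absolutelyContinuousOnInterval
  have hcJ : AbsolutelyContinuousOnInterval (fun x => c + ∫ t in (0)..x, g t) 0 L := hc.add hJ
  have h := hcJ.integral_mul_deriv_eq_deriv_mul hηac
  rw [hη.eq_zero_of_notMem (x := 0) (by simp), hη.eq_zero_of_notMem (x := L) (by simp)] at h
  have e : ∫ x in (0)..L, deriv (fun x => c + ∫ t in (0)..x, g t) x * η x
      = ∫ x in (0)..L, g x * η x := by
    refine intervalIntegral.integral_congr_ae ?_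
    filter_upwards [hg.ae_hasDerivAt_integral] with x hx hx'
    rw [((hx (uIoc_subset_uIcc hx') 0 (by simp)).const_add c).deriv]
  have e0 : ∀ f : ℝ → ℝ, ∫ x in (0)..L, f x = ∫ x in Ioo 0 L, f x := fun f => by
    rw [intervalIntegral.integral_of_le hL.le, integral_Ioc_eq_integral_Ioo]
  rw [e, e0 (fun x => g x * η x), e0 (fun x => (c + ∫ t in (0)..x, g t) * deriv η x)] at h
  rw [h]
  ring

/-- A test function with zero mean is the derivative of a test function. -/
theorem IsTestFunction.exists_primitive {χ : ℝ → ℝ} (h : IsTestFunction (Ioo 0 L) χ)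
    (h0 : ∫ x, χ x = 0) : ∃ η : ℝ → ℝ, IsTestFunction (Ioo 0 L) η ∧ deriv η = χ := by
  have hχ : Continuous χ := h.smooth.continuous
  rcases (tsupport χ).eq_empty_or_nonempty with he | hne
  · refine ⟨χ, h, ?_⟩
    rw [tsupport_eq_empty_iff] at he
    subst he
    ext x
    exact deriv_const x (0 : ℝ)
  obtain ⟨p, hp, hp'⟩ := h.compact.isCompact.exists_isLeast hne
  obtain ⟨q, hq, hq'⟩ := h.compact.isCompact.exists_isGreatest hne
  have hz : ∀ x, x ∉ Icc p q → χ x = 0 := fun x hx =>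
    image_eq_zero_of_notMem_tsupport fun hx' => hx ⟨hp' hx', hq' hx'⟩
  have hp0 := (h.support hp).1
  have hqL := (h.support hq).2
  have hη : ∀ x, x ∉ Icc p q → ∫ t in (0)..x, χ t = 0 := by
    intro x hx
    rcases lt_or_ge x p with hxp | hxp
    · rw [intervalIntegral.integral_congr (g := fun _ => (0 : ℝ)), intervalIntegral.integral_zero]
      intro t ht
      refine hz t fun ht' => ?_
      have := ht.2
      have : t < p := lt_of_le_of_lt this (max_lt hp0 hxp)
      linarith [ht'.1]
    · have hxq : q < x := by
        by_contra hc
        exact hx ⟨hxp, not_lt.1 hc⟩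
      rw [intervalIntegral.integral_eq_integral_of_support_subset, h0]
      intro t ht
      have : t ∈ Icc p q := by
        by_contra hc
        exact ht (hz t hc)
      exact ⟨hp0.trans_le this.1, this.2.trans hxq.le⟩
  have hd : deriv (fun x => ∫ t in (0)..x, χ t) = χ := by
    ext x
    exact hχ.deriv_integral _ _ _
  have hsub : tsupport (fun x => ∫ t in (0)..x, χ t) ⊆ Icc p q :=
    closure_minimal (fun x hx => by
      by_contra hc
      exact hx (hη x hc)) isClosed_Icc
  refine ⟨_, ⟨?_, ?_, ?_⟩, hd⟩
  · rw [contDiff_infty_iff_deriv, hd]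
    exact ⟨fun x => (hχ.integral_hasStrictDerivAt 0 x).hasDerivAt.differentiableAt, h.smooth⟩
  · exact isCompact_Icc.of_isClosed_subset (isClosed_tsupport _) hsub
  · exact hsub.trans fun x hx => ⟨hp0.trans_le hx.1, hx.2.trans_lt hqL⟩

theorem IsTestFunction.integrable {η : ℝ → ℝ} {Ω : Set ℝ} (h : IsTestFunction Ω η) :
    Integrable η :=
  h.smooth.continuous.integrable_of_hasCompactSupport h.compact

/-- The lemma of du Bois-Reymond: a function with vanishing weak derivative on an interval is
constant. A test function minus the multiple of a fixed one that gives it zero mean is a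
derivative. -/
theorem ae_eq_const_of_weak_deriv_zero (hL : 0 < L) {w : ℝ → ℝ}
    (hw : MemLp w 2 (volume.restrict (Ioo 0 L)))
    (h : ∀ η : ℝ → ℝ, IsTestFunction (Ioo 0 L) η → ∫ x in Ioo 0 L, w x * deriv η x = 0) :
    ∃ c : ℝ, ∀ᵐ x ∂volume.restrict (Ioo 0 L), w x = c := by
  let f : ContDiffBump (L / 2) := ⟨L / 8, L / 4, by positivity, by linarith⟩
  have hρ : IsTestFunction (Ioo 0 L) (f.normed volume) := by
    refine ⟨f.contDiff_normed, f.hasCompactSupport_normed, ?_⟩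
    rw [f.tsupport_normed_eq, Real.closedBall_eq_Icc]
    intro x hx
    have h1 : L / 2 - L / 4 ≤ x := hx.1
    have h2 : x ≤ L / 2 + L / 4 := hx.2
    constructor <;> linarith
  set ρ := f.normed volume with hρdef
  have hρ1 : ∫ x, ρ x = 1 := f.integral_normed
  have hwi : Integrable w (volume.restrict (Ioo 0 L)) := hw.integrable (by norm_num)
  refine ⟨∫ x in Ioo 0 L, w x * ρ x, ?_⟩
  set c := ∫ x in Ioo 0 L, w x * ρ x with hc
  rw [ae_restrict_iff' measurableSet_Ioo]
  have key := isOpen_Ioo.ae_eq_zero_of_integral_contDiff_smul_eq_zero (U := Ioo 0 L)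
    (μ := (volume : Measure ℝ)) (f := fun x => w x - c)
    (IntegrableOn.locallyIntegrableOn (hwi.sub (integrable_const c))) ?_
  · filter_upwards [key] with x hx hx'
    exact sub_eq_zero.1 (hx hx')
  intro ψ hψ1 hψ2 hψ3
  have hψ : IsTestFunction (Ioo 0 L) ψ := ⟨hψ1, hψ2, hψ3⟩
  have hset : ∀ u : ℝ → ℝ, ∫ x, ψ x * u x = ∫ x in Ioo 0 L, ψ x * u x := fun u =>
    (setIntegral_eq_integral_of_forall_compl_eq_zero fun x hx => by
      rw [hψ.eq_zero_of_notMem hx, zero_mul]).symm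
  simp only [smul_eq_mul]
  set m := ∫ x, ψ x with hm
  have hm' : ∫ x in Ioo 0 L, ψ x = m :=
    setIntegral_eq_integral_of_forall_compl_eq_zero fun x hx => hψ.eq_zero_of_notMem hx
  have hχ : IsTestFunction (Ioo 0 L) (fun x => ψ x - m * ρ x) := by
    refine ⟨hψ.smooth.sub (contDiff_const.mul hρ.smooth),
      hψ.compact.sub (hρ.compact.mul_left (f := fun _ => m)), ?_⟩
    refine (tsupport_sub _ _).trans (union_subset hψ.support ?_)
    exact (closure_mono (Function.support_mul_subset_right (fun _ => m) ρ)).trans hρ.support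
  have hχ0 : ∫ x, (ψ x - m * ρ x) = 0 := by
    rw [integral_sub hψ.integrable (hρ.integrable.const_mul m), integral_const_mul, hρ1, ← hm]
    ring
  obtain ⟨η, hη, hdη⟩ := hχ.exists_primitive hχ0
  have h1 := h η hη
  have i1 : Integrable (fun x => w x * ψ x) (volume.restrict (Ioo 0 L)) :=
    hw.integrable_mul hψ.memLp
  have i2 : Integrable (fun x => w x * ρ x) (volume.restrict (Ioo 0 L)) :=
    hw.integrable_mul hρ.memLp
  have e1 : ∫ x in Ioo 0 L, w x * deriv η x = (∫ x in Ioo 0 L, w x * ψ x) - m * c := by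
    rw [hdη, hc, ← integral_const_mul, ← integral_sub i1 (i2.const_mul m)]
    congr 1
    ext x
    ring
  have e2 : ∫ x in Ioo 0 L, ψ x * (w x - c) = (∫ x in Ioo 0 L, w x * ψ x) - c * m := by
    rw [← hm', ← integral_const_mul, ← integral_sub i1 (hψ.integrable.restrict.const_mul c)]
    congr 1
    ext x
    ring
  rw [hset, e2]
  linarith

theorem abs_primitive_le (g : L2 (Ioo 0 L) ℝ) {x : ℝ} (hx : x ∈ Icc 0 L) :
    |∫ t in (0)..x, g t| ≤ √L * ‖g‖ := by
  rw [intervalIntegral.integral_of_le hx.1, integral_Ioc_eq_integral_Ioo]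
  refine (abs_setIntegral_le measurableSet_Ioo (by simp)
    (Ioo_subset_Ioo_right hx.2) g).trans ?_
  gcongr
  simp [hx.1, hx.2]

theorem continuousOn_primitive (hL : 0 < L) (g : L2 (Ioo 0 L) ℝ) (c : ℝ) :
    ContinuousOn (fun x => c + ∫ t in (0)..x, g t) (Icc 0 L) := by
  have h := ((intervalIntegrable_of_L2 hL g).absolutelyContinuousOnInterval_intervalIntegral
    (c := 0) (by simp)).continuousOn
  rw [uIcc_of_le hL.le] at h
  exact continuousOn_const.add h

/-- The fundamental theorem of calculus in `H¹(0, L)`. -/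
theorem exists_eq_const_add_primitive (hL : 0 < L) (θ : W L) :
    ∃ c : ℝ, θ.1.fst =ᵐ[volume.restrict (Ioo 0 L)] fun x => c + ∫ t in (0)..x, θ.1.snd t := by
  set J : ℝ → ℝ := fun x => 0 + ∫ t in (0)..x, θ.1.snd t with hJ
  have hJm : MemLp J 2 (volume.restrict (Ioo 0 L)) := by
    refine MemLp.of_bound
      (((continuousOn_primitive hL θ.1.snd 0).mono Ioo_subset_Icc_self).aestronglyMeasurable
        measurableSet_Ioo) (√L * ‖θ.1.snd‖) ?_
    filter_upwards [ae_restrict_mem measurableSet_Ioo] with x hx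
    simpa [hJ] using abs_primitive_le θ.1.snd (Ioo_subset_Icc_self hx)
  have hθ : MemLp θ.1.fst 2 (volume.restrict (Ioo 0 L)) := Lp.memLp _
  obtain ⟨c, hc⟩ := ae_eq_const_of_weak_deriv_zero hL (hθ.sub hJm) (fun η hη => by
    have h1 := isWeakGradient_real_iff.1 θ.2 η hη
    have h2 := isWeakGradient_real_iff.1
      (isWeakGradient_primitive hL (intervalIntegrable_of_L2 hL θ.1.snd) 0) η hη
    have hd : MemLp (deriv η) 2 (volume.restrict (Ioo 0 L)) := by
      simpa [fderiv_apply_real] using hη.memLp_fderiv 1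
    simp only [Pi.sub_apply, sub_mul]
    have h3 := integral_sub (hθ.integrable_mul hd) (hJm.integrable_mul hd)
    simp only [Pi.mul_apply] at h3
    rw [h3, h1, h2, sub_self])
  refine ⟨c, ?_⟩
  filter_upwards [hc] with x hx
  simp only [Pi.sub_apply, hJ, zero_add] at hx
  linarith

theorem exists_contRep_eq (hL : 0 < L) (θ : W L) :
    ∃ c : ℝ, θ.1.fst =ᵐ[volume.restrict (Ioo 0 L)] (fun x => c + ∫ t in (0)..x, θ.1.snd t) ∧
      EqOn (contRep L θ.1.fst) (fun x => c + ∫ t in (0)..x, θ.1.snd t) (Icc 0 L) := by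
  obtain ⟨c, hc⟩ := exists_eq_const_add_primitive hL θ
  exact ⟨c, hc, contRep_eqOn hL _ _ (continuousOn_primitive hL θ.1.snd c) hc⟩

theorem continuousOn_contRep (hL : 0 < L) (θ : W L) :
    ContinuousOn (contRep L θ.1.fst) (Icc 0 L) := by
  obtain ⟨c, -, h⟩ := exists_contRep_eq hL θ
  exact (continuousOn_primitive hL θ.1.snd c).congr h

theorem contRep_ae_eq (hL : 0 < L) (θ : W L) :
    θ.1.fst =ᵐ[volume.restrict (Ioo 0 L)] contRep L θ.1.fst := by
  obtain ⟨c, h1, h⟩ := exists_contRep_eq hL θ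
  filter_upwards [h1, ae_restrict_mem measurableSet_Ioo] with x hx hx'
  rw [hx, h (Ioo_subset_Icc_self hx')]

theorem abs_contRep_sub_le (hL : 0 < L) (θ : W L) {x : ℝ} (hx : x ∈ Icc 0 L) :
    |contRep L θ.1.fst x - contRep L θ.1.fst 0| ≤ √L * ‖θ.1.snd‖ := by
  obtain ⟨c, -, h⟩ := exists_contRep_eq hL θ
  rw [h hx, h (left_mem_Icc.2 hL.le)]
  simpa using abs_primitive_le θ.1.snd hx

/-- The value at `0` together with the derivative controls the `L²` norm. -/
theorem norm_fst_le (hL : 0 < L) (θ : W L) :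
    ‖θ.1.fst‖ ≤ √L * |contRep L θ.1.fst 0| + L * ‖θ.1.snd‖ := by
  have h : ∀ᵐ x ∂volume.restrict (Ioo 0 L),
      ‖θ.1.fst x‖ ≤ |contRep L θ.1.fst 0| + √L * ‖θ.1.snd‖ := by
    filter_upwards [contRep_ae_eq hL θ, ae_restrict_mem measurableSet_Ioo] with x hx hx'
    rw [hx, Real.norm_eq_abs]
    have h1 := abs_contRep_sub_le hL θ (Ioo_subset_Icc_self hx')
    have h2 := abs_sub_abs_le_abs_sub (contRep L θ.1.fst x) (contRep L θ.1.fst 0)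
    linarith
  refine (Lp.norm_le_of_ae_bound (by positivity) h).trans (le_of_eq ?_)
  have h3 : √L * √L = L := Real.mul_self_sqrt hL.le
  have h4 : (measureUnivNNReal (volume.restrict (Ioo 0 L)) : ℝ) ^ (ENNReal.toReal 2)⁻¹ = √L := by
    simp [Real.sqrt_eq_rpow, measureUnivNNReal, ENNReal.coe_toNNReal_eq_toReal, hL.le]
  rw [h4, mul_add, ← mul_assoc, h3]

/-- The trace inequality at `0`. -/
theorem abs_contRep_zero_le (hL : 0 < L) (θ : W L) :
    √L * |contRep L θ.1.fst 0| ≤ ‖θ.1.fst‖ + L * ‖θ.1.snd‖ := by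
  set c := contRep L θ.1.fst 0
  have h3 : √L * √L = L := Real.mul_self_sqrt hL.le
  have hs : 0 < √L := Real.sqrt_pos.2 hL
  have hi : Integrable θ.1.fst (volume.restrict (Ioo 0 L)) :=
    (Lp.memLp θ.1.fst).integrable (by norm_num)
  have h1 : |∫ x in Ioo 0 L, θ.1.fst x| ≤ √L * ‖θ.1.fst‖ := by
    simpa [hL.le] using abs_setIntegral_le measurableSet_Ioo (by simp) subset_rfl θ.1.fst
  have h2 : |∫ x in Ioo 0 L, (θ.1.fst x - c)| ≤ √L * ‖θ.1.snd‖ * L := by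
    have := norm_setIntegral_le_of_norm_le_const_ae' (μ := volume) (s := Ioo 0 L)
      (f := fun x => θ.1.fst x - c) (C := √L * ‖θ.1.snd‖) (by simp) (by
        rw [← ae_restrict_iff' measurableSet_Ioo]
        filter_upwards [contRep_ae_eq hL θ, ae_restrict_mem measurableSet_Ioo] with x hx hx'
        rw [hx]
        exact abs_contRep_sub_le hL θ (Ioo_subset_Icc_self hx'))
    simpa [hL.le] using this
  rw [integral_sub hi (integrable_const c)] at h2
  have h4 : ∫ _ in Ioo 0 L, c = L * c := by simp [hL.le]
  rw [h4] at h2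
  have h5 : L * |c| ≤ √L * ‖θ.1.fst‖ + √L * ‖θ.1.snd‖ * L := by
    have h6 : |L * c| = L * |c| := by rw [abs_mul, abs_of_pos hL]
    have := abs_sub_abs_le_abs_sub (L * c) (∫ x in Ioo 0 L, θ.1.fst x)
    rw [abs_sub_comm (L * c)] at this
    linarith
  have h6 : √L * (√L * |c|) ≤ √L * (‖θ.1.fst‖ + L * ‖θ.1.snd‖) := by
    rw [← mul_assoc, h3]
    linarith
  exact le_of_mul_le_mul_left h6 hs

/-- Evaluation of the continuous representative at a point of `[0, L]`, on `H¹(0, L)`. -/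
def traceLM (hL : 0 < L) {x : ℝ} (hx : x ∈ Icc 0 L) : W L →ₗ[ℝ] ℝ where
  toFun θ := contRep L θ.1.fst x
  map_add' θ δ := by
    refine contRep_eqOn hL _ (fun y => contRep L θ.1.fst y + contRep L δ.1.fst y)
      ((continuousOn_contRep hL θ).add (continuousOn_contRep hL δ)) ?_ hx
    filter_upwards [Lp.coeFn_add θ.1.fst δ.1.fst, contRep_ae_eq hL θ, contRep_ae_eq hL δ]
      with y h1 h2 h3
    rw [← h2, ← h3]
    exact h1
  map_smul' r θ := by
    refine contRep_eqOn hL _ (fun y => r * contRep L θ.1.fst y)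
      (continuousOn_const.mul (continuousOn_contRep hL θ)) ?_ hx
    filter_upwards [Lp.coeFn_smul r θ.1.fst, contRep_ae_eq hL θ] with y h1 h2
    rw [← h2]
    exact h1

/-- The trace at a point of `[0, L]` as a continuous functional on `H¹(0, L)`. -/
def traceL (hL : 0 < L) {x : ℝ} (hx : x ∈ Icc 0 L) : W L →L[ℝ] ℝ :=
  (traceLM hL hx).mkContinuous ((1 + L) / √L + √L) fun θ => by
    have hs : 0 < √L := Real.sqrt_pos.2 hL
    have h1 := abs_contRep_zero_le hL θ
    have h2 := abs_contRep_sub_le hL θ hx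
    have h3 := abs_sub_abs_le_abs_sub (contRep L θ.1.fst x) (contRep L θ.1.fst 0)
    have h4 : ‖θ.1.fst‖ ≤ ‖θ‖ := WithLp.norm_fst_le (x := θ.1)
    have h5 : ‖θ.1.snd‖ ≤ ‖θ‖ := WithLp.norm_snd_le (x := θ.1)
    have h6 : |contRep L θ.1.fst 0| ≤ (1 + L) / √L * ‖θ‖ := by
      rw [div_mul_eq_mul_div, le_div_iff₀ hs]
      nlinarith
    have h7 : √L * ‖θ.1.snd‖ ≤ √L * ‖θ‖ := by gcongr
    change |contRep L θ.1.fst x| ≤ _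
    linarith

/-- The affine function `p + q x`, as an element of `H¹(0, L)`. -/
theorem exists_affine (hL : 0 < L) (p q : ℝ) : ∃ θ : W L,
    θ.1.fst =ᵐ[volume.restrict (Ioo 0 L)] fun x => p + q * x := by
  have hf : MemLp (fun x : ℝ => p + q * x) 2 (volume.restrict (Ioo 0 L)) :=
    MemLp.of_bound (by fun_prop) (|p| + |q| * L) (by
      filter_upwards [ae_restrict_mem measurableSet_Ioo] with x hx
      refine (norm_add_le _ _).trans ?_
      rw [norm_mul, Real.norm_eq_abs, Real.norm_eq_abs, Real.norm_eq_abs, abs_of_pos hx.1]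
      gcongr
      exact hx.2.le)
  have hg : MemLp (fun _ : ℝ => q) 2 (volume.restrict (Ioo 0 L)) := memLp_const q
  refine ⟨⟨WithLp.toLp 2 (hf.toLp _, hg.toLp _), ?_⟩, hf.coeFn_toLp⟩
  change IsWeakGradient _ (hf.toLp _) (hg.toLp _)
  have h := isWeakGradient_real_iff.1
    (isWeakGradient_primitive hL (g := fun _ => q) intervalIntegrable_const p)
  refine isWeakGradient_real_iff.2 fun η hη => ?_
  have h1 := h η hη
  have e1 : ∫ x in Ioo 0 L, hf.toLp _ x * deriv η x
      = ∫ x in Ioo 0 L, (p + ∫ t in (0)..x, q) * deriv η x := by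
    refine integral_congr_ae ?_
    filter_upwards [hf.coeFn_toLp] with x hx
    rw [hx]
    simp [mul_comm]
  have e2 : ∫ x in Ioo 0 L, hg.toLp _ x * η x = ∫ x in Ioo 0 L, q * η x := by
    refine integral_congr_ae ?_
    filter_upwards [hg.coeFn_toLp] with x hx
    rw [hx]
  rw [e1, e2, h1]

end Interval


/-! ### The Poincaré inequality in `H¹₀` -/

section Poincare

variable {d : ℕ} {Ω : Set (Space d)}

theorem norm_sq_eq_setIntegral {E F : Type*} [MeasureSpace E] [NormedAddCommGroup F]
    [InnerProductSpace ℝ F] {Ω : Set E} {f : L2 Ω F} {g : E → F}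
    (h : f =ᵐ[volume.restrict Ω] g) : ‖f‖ ^ 2 = ∫ x in Ω, ‖g x‖ ^ 2 := by
  rw [← real_inner_self_eq_norm_sq, L2.inner_def]
  refine integral_congr_ae ?_
  filter_upwards [h] with x hx
  rw [hx, real_inner_self_eq_norm_sq]

/-- The Poincaré inequality for a test function. Integration by parts against the coordinate
`x i` gives `∫ η² = - 2 ∫ x i * η * ∂ᵢ η`, and Young's inequality absorbs half of the left side. -/
theorem IsTestFunction.poincare (i : Fin d) {R : ℝ} (hR : ∀ x ∈ Ω, ‖x‖ ≤ R)
    {η : Space d → ℝ} (h : IsTestFunction Ω η) :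
    ∫ x in Ω, ‖η x‖ ^ 2 ≤ 4 * R ^ 2 * ∫ x in Ω, ‖gradient η x‖ ^ 2 := by
  have hz : ∀ x, x ∉ Ω → η x = 0 := fun x hx =>
    image_eq_zero_of_notMem_tsupport fun hx' => hx (h.support hx')
  have hz' : ∀ x, x ∉ Ω → gradient η x = 0 := fun x hx => by
    have : fderiv ℝ η x = 0 := image_eq_zero_of_notMem_tsupport
      fun hx' => hx (h.support (tsupport_fderiv_subset ℝ hx'))
    rw [gradient, this, map_zero]
  rw [setIntegral_eq_integral_of_forall_compl_eq_zero (fun x hx => by rw [hz x hx]; simp),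
    setIntegral_eq_integral_of_forall_compl_eq_zero (fun x hx => by rw [hz' x hx]; simp)]
  set e : Space d := EuclideanSpace.single i 1 with he
  have hηc : Continuous η := h.smooth.continuous
  have hηd : Differentiable ℝ η := h.smooth.differentiable (by simp)
  have hfc : Continuous (fun x => fderiv ℝ η x) := h.smooth.continuous_fderiv (by simp)
  have hgc : Continuous (fun x => gradient η x) :=
    (InnerProductSpace.toDual ℝ (Space d)).symm.continuous.comp hfc
  have hsq : ∀ x, fderiv ℝ (fun y => η y ^ 2) x e = 2 * η x * fderiv ℝ η x e := fun x => by
    rw [fderiv_fun_pow 2 (hηd x)]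
    simp
  have hxi : ∀ x : Space d, fderiv ℝ (fun y : Space d => y i) x e = 1 := fun x => by
    have := (EuclideanSpace.proj (𝕜 := ℝ) i).fderiv (x := x)
    change fderiv ℝ (EuclideanSpace.proj (𝕜 := ℝ) i) x e = 1
    rw [this]
    simp [he]
  have hcs : HasCompactSupport (fun x => η x ^ 2) :=
    h.compact.comp_left (g := fun t : ℝ => t ^ 2) (by simp)
  have i0 : Integrable (fun x => η x ^ 2) :=
    (hηc.pow 2).integrable_of_hasCompactSupport hcs
  have i1 : Integrable (fun x => x i * (2 * η x * fderiv ℝ η x e)) := by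
    refine Continuous.integrable_of_hasCompactSupport ?_ ?_
    · have := hfc.clm_apply (continuous_const (y := e))
      fun_prop
    · exact (h.compact.mul_left (f := fun _ => (2 : ℝ))).mul_right.mul_left
  have i2 : Integrable (fun x => x i * η x ^ 2) := by
    refine Continuous.integrable_of_hasCompactSupport (by fun_prop) hcs.mul_left
  have i3 : Integrable (fun x => ‖gradient η x‖ ^ 2) := by
    refine Continuous.integrable_of_hasCompactSupport (hgc.norm.pow 2) ?_
    refine HasCompactSupport.of_support_subset_isCompact h.compact.isCompact ?_
    intro x hx
    by_contra hc
    refine hx ?_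
    have : fderiv ℝ η x = 0 := image_eq_zero_of_notMem_tsupport
      fun hx' => hc (tsupport_fderiv_subset ℝ hx')
    simp [gradient, this]
  have ibp := integral_mul_fderiv_eq_neg_fderiv_mul_of_integrable (𝕜 := ℝ)
    (μ := (volume : Measure (Space d))) (f := fun x : Space d => x i) (g := fun x => η x ^ 2)
    (v := e) (by simpa [hxi] using i0) (by simpa [hsq] using i1) i2
    (fun x _ => (EuclideanSpace.proj (𝕜 := ℝ) i).differentiableAt)
    (fun x _ => (hηd x).pow 2)
  simp only [hsq, hxi, one_mul] at ibp
  have hpt : ∀ x, -(x i * (2 * η x * fderiv ℝ η x e))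
      ≤ 1 / 2 * η x ^ 2 + 2 * R ^ 2 * ‖gradient η x‖ ^ 2 := by
    intro x
    by_cases hx : x ∈ Ω
    · have h1 : |x i| ≤ R := (PiLp.norm_apply_le x i).trans (hR x hx)
      have h2 : |fderiv ℝ η x e| ≤ ‖gradient η x‖ := by
        have h3 : ‖gradient η x‖ = ‖fderiv ℝ η x‖ := by simp [gradient]
        rw [h3]
        refine ((fderiv ℝ η x).le_opNorm e).trans ?_
        simp [he]
      have h4 : |x i * fderiv ℝ η x e| ≤ R * ‖gradient η x‖ := by
        rw [abs_mul]
        gcongr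
        exact (abs_nonneg _).trans h1
      have h5 := sq_le_sq' (neg_le_of_abs_le h4) (le_of_abs_le h4)
      nlinarith [sq_nonneg (η x + 2 * (x i * fderiv ℝ η x e))]
    · rw [hz x hx]
      simp only [mul_zero, zero_mul, neg_zero]
      positivity
  have hfin : ∫ x, η x ^ 2
      ≤ 1 / 2 * (∫ x, η x ^ 2) + 2 * R ^ 2 * ∫ x, ‖gradient η x‖ ^ 2 := by
    rw [← integral_const_mul, ← integral_const_mul,
      ← integral_add (i0.const_mul _) (i3.const_mul _)]
    calc ∫ x, η x ^ 2 = ∫ x, -(x i * (2 * η x * fderiv ℝ η x e)) := by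
          rw [integral_neg, ibp, neg_neg]
      _ ≤ _ := integral_mono i1.neg ((i0.const_mul _).add (i3.const_mul _)) hpt
  simp only [Real.norm_eq_abs, sq_abs]
  linarith

theorem poincare_H10 (i : Fin d) {R : ℝ} (hR0 : 0 ≤ R) (hR : ∀ x ∈ Ω, ‖x‖ ≤ R) (φ : U Ω) :
    ‖φ.1.fst‖ ≤ 2 * R * ‖φ.1.snd‖ := by
  let C : Set (L2Pair Ω) := {p | ‖p.fst‖ ≤ 2 * R * ‖p.snd‖}
  have hC : IsClosed C := isClosed_le (by fun_prop) (by fun_prop)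
  refine closure_minimal (t := C) ?_ hC φ.2
  intro p hp
  -- linear combinations of the generators are again pairs of a test function and its gradient
  have hp' : ∃ η : Space d → ℝ, IsTestFunction Ω η ∧ p.fst =ᵐ[volume.restrict Ω] η ∧
      p.snd =ᵐ[volume.restrict Ω] fun x => gradient η x := by
    induction hp using Submodule.span_induction with
    | mem p hp => exact hp
    | zero =>
      refine ⟨0, ⟨contDiff_const, HasCompactSupport.zero, by simp⟩, Lp.coeFn_zero .., ?_⟩
      refine (Lp.coeFn_zero ..).trans (Filter.Eventually.of_forall fun x => ?_)
      simp [gradient]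
    | add p q _ _ hp hq =>
      obtain ⟨η, hη, h1, h2⟩ := hp
      obtain ⟨ξ, hξ, h3, h4⟩ := hq
      refine ⟨η + ξ, ⟨hη.smooth.add hξ.smooth, hη.compact.add hξ.compact,
        (tsupport_add _ _).trans (union_subset hη.support hξ.support)⟩, ?_, ?_⟩
      · exact (Lp.coeFn_add p.fst q.fst).trans (h1.add h3)
      · refine (Lp.coeFn_add p.snd q.snd).trans ((h2.add h4).trans
          (Filter.Eventually.of_forall fun x => ?_))
        have := fderiv_add (hη.smooth.differentiable (by simp) x)
          (hξ.smooth.differentiable (by simp) x)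
        simp [gradient, this]
    | smul c p _ hp =>
      obtain ⟨η, hη, h1, h2⟩ := hp
      refine ⟨c • η, ⟨contDiff_const.smul hη.smooth, hη.compact.smul_left (f := fun _ => c),
        (closure_mono (Function.support_const_smul_subset c η)).trans hη.support⟩, ?_, ?_⟩
      · exact (Lp.coeFn_smul c p.fst).trans (h1.const_smul c)
      · refine (Lp.coeFn_smul c p.snd).trans ((h2.const_smul c).trans
          (Filter.Eventually.of_forall fun x => ?_))
        have := fderiv_const_smul (hη.smooth.differentiable (by simp) x) c
        simp [gradient, this]
  obtain ⟨η, hη, h1, h2⟩ := hp'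
  have h := hη.poincare i hR
  rw [← norm_sq_eq_setIntegral h1, ← norm_sq_eq_setIntegral h2] at h
  refine (sq_le_sq₀ (norm_nonneg _) (by positivity)).1 (h.trans (le_of_eq ?_))
  ring

end Poincare


/-! ### The forms of the continuum/wire problem -/

section Forms

variable {d : ℕ} {Ω : Set (Space d)} {L : ℝ}

instance : CompleteSpace (U Ω) :=
  (Submodule.isClosed_topologicalClosure _).completeSpace_coe

instance : CompleteSpace (W L) := (isClosed_H1 _).completeSpace_coe

theorem norm_V_sq (v : V Ω L) :
    ‖v‖ ^ 2 = ‖bodyTemp v‖ ^ 2 + ‖bodyGrad v‖ ^ 2 + (‖wireTemp v‖ ^ 2 + ‖wireDeriv v‖ ^ 2) := by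
  rw [WithLp.prod_norm_sq_eq_of_L2]
  exact congrArg₂ (· + ·) (WithLp.prod_norm_sq_eq_of_L2 v.fst.1)
    (WithLp.prod_norm_sq_eq_of_L2 v.snd.1)

/-- The norm `normV` is equivalent to the norm of the Hilbert space `V`. -/
theorem exists_normV_equiv {ℓ : ℝ} (hL : 0 < L) (hℓ : 0 < ℓ) :
    ∃ c₁ > 0, ∃ c₂ > 0, ∀ v : V Ω L, c₁ * ‖v‖ ≤ normV ℓ v ∧ normV ℓ v ≤ c₂ * ‖v‖ := by
  have hp : 0 < ℓ ^ (d - 1) := by positivity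
  set w₂ := ℓ ^ 2 with hw₂
  set w₃ := ℓ ^ (d - 1) with hw₃
  set w₄ := w₃ * L ^ 2 with hw₄
  have h2 : 0 < w₂ := by positivity
  have h4 : 0 < w₄ := by positivity
  set m := min (min 1 w₂) (min w₃ w₄) with hm
  have hm0 : 0 < m := by simp [hm, h2, hp, h4]
  have hm1 : m ≤ 1 := (min_le_left _ _).trans (min_le_left _ _)
  have hm2 : m ≤ w₂ := (min_le_left _ _).trans (min_le_right _ _)
  have hm3 : m ≤ w₃ := (min_le_right _ _).trans (min_le_left _ _)
  have hm4 : m ≤ w₄ := (min_le_right _ _).trans (min_le_right _ _)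
  set M := 1 + w₂ + w₃ + w₄ with hM
  have hM0 : 0 < M := by positivity
  refine ⟨√m, Real.sqrt_pos.2 hm0, √M, Real.sqrt_pos.2 hM0, fun v => ?_⟩
  have e : ∀ r : ℝ, 0 ≤ r → √r * ‖v‖ = √(r * ‖v‖ ^ 2) := fun r hr => by
    rw [Real.sqrt_mul hr, Real.sqrt_sq (norm_nonneg _)]
  have s1 := sq_nonneg ‖bodyTemp v‖
  have s2 := sq_nonneg ‖bodyGrad v‖
  have s3 := sq_nonneg ‖wireTemp v‖
  have s4 := sq_nonneg ‖wireDeriv v‖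
  have e' : ℓ ^ (d - 1) * (‖wireTemp v‖ ^ 2 + L ^ 2 * ‖wireDeriv v‖ ^ 2)
      = w₃ * ‖wireTemp v‖ ^ 2 + w₄ * ‖wireDeriv v‖ ^ 2 := by rw [hw₄]; ring
  rw [e m hm0.le, e M hM0.le, norm_V_sq, normV, e', ← hw₂]
  constructor
  · refine Real.sqrt_le_sqrt ?_
    linarith [mul_le_mul_of_nonneg_right hm1 s1, mul_le_mul_of_nonneg_right hm2 s2,
      mul_le_mul_of_nonneg_right hm3 s3, mul_le_mul_of_nonneg_right hm4 s4]
  · refine Real.sqrt_le_sqrt ?_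
    have k1 : 1 ≤ M := by linarith
    have k2 : w₂ ≤ M := by linarith
    have k3 : w₃ ≤ M := by linarith
    have k4 : w₄ ≤ M := by linarith
    linarith [mul_le_mul_of_nonneg_right k1 s1, mul_le_mul_of_nonneg_right k2 s2,
      mul_le_mul_of_nonneg_right k3 s3, mul_le_mul_of_nonneg_right k4 s4]

theorem formA_eq_inner (κ κb : ℝ) (u v : V Ω L) :
    formA κ κb u v
      = κ * inner ℝ (bodyGrad u) (bodyGrad v) + κb * inner ℝ (wireDeriv u) (wireDeriv v) := by
  rw [formA, integral_const_mul, integral_const_mul, L2.inner_def, L2.inner_def]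
  congr 2
  refine integral_congr_ae (Filter.Eventually.of_forall fun x => ?_)
  simp [mul_comm]

/-- The body temperature, as a continuous linear map on `V`. -/
def bodyTempL (Ω : Set (Space d)) (L : ℝ) : V Ω L →L[ℝ] L2 Ω ℝ :=
  WithLp.fstL 2 ℝ (L2 Ω ℝ) (L2 Ω (Space d)) ∘L (U Ω).subtypeL ∘L WithLp.fstL 2 ℝ (U Ω) (W L)

/-- The gradient of the body temperature, as a continuous linear map on `V`. -/
def bodyGradL (Ω : Set (Space d)) (L : ℝ) : V Ω L →L[ℝ] L2 Ω (Space d) :=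
  WithLp.sndL 2 ℝ (L2 Ω ℝ) (L2 Ω (Space d)) ∘L (U Ω).subtypeL ∘L WithLp.fstL 2 ℝ (U Ω) (W L)

/-- The projection of `V` to the wire component. -/
def wireL (Ω : Set (Space d)) (L : ℝ) : V Ω L →L[ℝ] W L := WithLp.sndL 2 ℝ (U Ω) (W L)

/-- The derivative of the wire temperature, as a continuous linear map on `V`. -/
def wireDerivL (Ω : Set (Space d)) (L : ℝ) : V Ω L →L[ℝ] L2 (Ioo 0 L) ℝ :=
  WithLp.sndL 2 ℝ (L2 (Ioo 0 L) ℝ) (L2 (Ioo 0 L) ℝ) ∘L (W L).subtypeL ∘L wireL Ω L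

/-- The form `formA` as a continuous bilinear form. -/
def formAL (Ω : Set (Space d)) (L κ κb : ℝ) : V Ω L →L[ℝ] V Ω L →L[ℝ] ℝ :=
  κ • (innerSL ℝ).bilinearComp (bodyGradL Ω L) (bodyGradL Ω L)
    + κb • (innerSL ℝ).bilinearComp (wireDerivL Ω L) (wireDerivL Ω L)

theorem formAL_apply (κ κb : ℝ) (u v : V Ω L) : formAL Ω L κ κb u v = formA κ κb u v := by
  rw [formA_eq_inner]
  rfl

/-- The map to `Q` with given components. -/
def pairL {X : Type*} [AddCommGroup X] [Module ℝ X] [TopologicalSpace X]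
    (f₀ f₁ : X →L[ℝ] ℝ) : X →L[ℝ] Q :=
  (EuclideanSpace.equiv (Fin 2) ℝ).symm.toContinuousLinearMap ∘L
    ContinuousLinearMap.pi ![f₀, f₁]

/-- The value of `θ` at `x` minus the mean of `φ` on `B`, as a continuous functional on `V`. -/
def endL {B : Set (Space d)} (hL : 0 < L) (hBm : MeasurableSet B) (hv : volume B ≠ ⊤) {x : ℝ}
    (hx : x ∈ Icc 0 L) : V Ω L →L[ℝ] ℝ :=
  traceL hL hx ∘L wireL Ω L
    - ((1 / volume.real B) • setIntegralL Ω hBm hv) ∘L bodyTempL Ω L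

theorem endL_apply {B : Set (Space d)} (hL : 0 < L) (hBm : MeasurableSet B) (hB : B ⊆ Ω)
    (hv : volume B ≠ ⊤) {x : ℝ} (hx : x ∈ Icc 0 L) (v : V Ω L) :
    endL hL hBm hv hx v = contRep L (wireTemp v) x - mean B (bodyTemp v) := by
  rw [mean, ← setIntegralL_apply hBm hv hB]
  rfl

/-- The constraint operator `v ↦ (θ(0) - mean of φ on B₁, θ(L) - mean of φ on B₂)`. -/
theorem exists_formB_clm {B₁ B₂ : Set (Space d)} (hL : 0 < L)
    (hB₁m : MeasurableSet B₁) (hB₂m : MeasurableSet B₂) (hB₁ : B₁ ⊆ Ω) (hB₂ : B₂ ⊆ Ω)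
    (hv₁ : volume B₁ ≠ ⊤) (hv₂ : volume B₂ ≠ ⊤) :
    ∃ b : V Ω L →L[ℝ] Q,
      (∀ v, b v 0 = contRep L (wireTemp v) 0 - mean B₁ (bodyTemp v)) ∧
      (∀ v, b v 1 = contRep L (wireTemp v) L - mean B₂ (bodyTemp v)) :=
  ⟨pairL (endL hL hB₁m hv₁ (left_mem_Icc.2 hL.le)) (endL hL hB₂m hv₂ (right_mem_Icc.2 hL.le)),
    fun v => endL_apply hL hB₁m hB₁ hv₁ _ v, fun v => endL_apply hL hB₂m hB₂ hv₂ _ v⟩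

theorem abs_mean_le {B : Set (Space d)} (hBm : MeasurableSet B) (hB : B ⊆ Ω) (hv : volume B ≠ ⊤)
    (φ : L2 Ω ℝ) : |mean B φ| ≤ 1 / volume.real B * √(volume.real B) * ‖φ‖ := by
  rw [mean, abs_mul, abs_of_nonneg (by positivity), mul_assoc]
  gcongr
  exact abs_setIntegral_le hBm hv hB φ

/-- Coercivity of `a` where `θ(0)` equals the mean of `φ` on `B`: the Poincaré inequality bounds
`φ` by `∇φ`, hence the mean and `θ(0)`, and `θ(0)` and `θ'` bound `θ`. -/
theorem exists_coercive {B : Set (Space d)} {κ κb : ℝ} (i : Fin d) (hΩb : Bornology.IsBounded Ω)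
    (hBm : MeasurableSet B) (hB : B ⊆ Ω) (hL : 0 < L) (hκ : 0 < κ) (hκb : 0 < κb) :
    ∃ α > 0, ∀ v : V Ω L, contRep L (wireTemp v) 0 = mean B (bodyTemp v) →
      α * ‖v‖ ^ 2 ≤ formA κ κb v v := by
  obtain ⟨R, hR0, hR⟩ := hΩb.exists_pos_norm_le
  have hv : volume B ≠ ⊤ := (hΩb.subset hB).measure_lt_top.ne
  set μ := 1 / volume.real B * √(volume.real B) with hμ
  have hμ0 : 0 ≤ μ := by positivity
  set P := 2 * R with hP
  set A := √L * (μ * P) with hA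
  have hA0 : 0 ≤ A := by positivity
  set K := P ^ 2 + 2 * A ^ 2 + 2 * L ^ 2 + 1 with hK
  have hK0 : 0 < K := by positivity
  set k := min κ κb with hk
  have hk0 : 0 < k := lt_min hκ hκb
  refine ⟨k / K, by positivity, fun v h0 => ?_⟩
  have h1 : ‖bodyTemp v‖ ≤ P * ‖bodyGrad v‖ := poincare_H10 i hR0.le hR v.fst
  have h2 : |contRep L (wireTemp v) 0| ≤ μ * (P * ‖bodyGrad v‖) := by
    rw [h0]
    refine (abs_mean_le hBm hB hv _).trans ?_
    gcongr
  have h3 : ‖wireTemp v‖ ≤ A * ‖bodyGrad v‖ + L * ‖wireDeriv v‖ := by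
    refine (norm_fst_le hL v.snd).trans ?_
    have : √L * |contRep L (wireTemp v) 0| ≤ √L * (μ * (P * ‖bodyGrad v‖)) := by gcongr
    have e : √L * (μ * (P * ‖bodyGrad v‖)) = A * ‖bodyGrad v‖ := by rw [hA]; ring
    exact add_le_add (this.trans e.le) le_rfl
  have g1 : ‖bodyTemp v‖ ^ 2 ≤ P ^ 2 * ‖bodyGrad v‖ ^ 2 := by
    rw [← mul_pow]
    exact pow_le_pow_left₀ (norm_nonneg _) h1 2
  have g3 : ‖wireTemp v‖ ^ 2
      ≤ 2 * (A ^ 2 * ‖bodyGrad v‖ ^ 2) + 2 * (L ^ 2 * ‖wireDeriv v‖ ^ 2) := by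
    have := pow_le_pow_left₀ (norm_nonneg _) h3 2
    linarith [sq_nonneg (A * ‖bodyGrad v‖ - L * ‖wireDeriv v‖)]
  have g : ‖v‖ ^ 2 ≤ K * (‖bodyGrad v‖ ^ 2 + ‖wireDeriv v‖ ^ 2) := by
    rw [norm_V_sq, hK]
    have s2 := sq_nonneg ‖bodyGrad v‖
    have s4 := sq_nonneg ‖wireDeriv v‖
    linarith [mul_nonneg (sq_nonneg P) s4, mul_nonneg (sq_nonneg A) s4,
      mul_nonneg (sq_nonneg L) s2]
  have ha : k * (‖bodyGrad v‖ ^ 2 + ‖wireDeriv v‖ ^ 2) ≤ formA κ κb v v := by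
    rw [formA_eq_inner, real_inner_self_eq_norm_sq, real_inner_self_eq_norm_sq, mul_add]
    gcongr
    · exact min_le_left _ _
    · exact min_le_right _ _
  calc k / K * ‖v‖ ^ 2 ≤ k / K * (K * (‖bodyGrad v‖ ^ 2 + ‖wireDeriv v‖ ^ 2)) := by gcongr
    _ = k * (‖bodyGrad v‖ ^ 2 + ‖wireDeriv v‖ ^ 2) := by field_simp
    _ ≤ _ := ha

/-- Pairs `(0, θ)` with `θ` affine attain all pairs of end values. -/
theorem exists_affine_wire (hL : 0 < L) (p q : ℝ) : ∃ v : V Ω L, v.fst = 0 ∧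
    contRep L (wireTemp v) 0 = p ∧ contRep L (wireTemp v) L = q ∧
    ∃ r s : ℝ, wireTemp v =ᵐ[volume.restrict (Ioo 0 L)] fun x => r + s * x := by
  obtain ⟨θ, hθ⟩ := exists_affine hL p ((q - p) / L)
  have hc : EqOn (contRep L θ.1.fst) (fun x => p + (q - p) / L * x) (Icc 0 L) :=
    contRep_eqOn hL _ _ (by fun_prop) hθ
  refine ⟨WithLp.toLp 2 (0, θ), rfl, ?_, ?_, _, _, hθ⟩
  · refine (hc (left_mem_Icc.2 hL.le)).trans ?_
    simp
  · refine (hc (right_mem_Icc.2 hL.le)).trans ?_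
    field_simp
    ring

theorem mean_bodyTemp_eq_zero {B : Set (Space d)} (hBm : MeasurableSet B) (hB : B ⊆ Ω)
    (hv : volume B ≠ ⊤) {v : V Ω L} (h : v.fst = 0) : mean B (bodyTemp v) = 0 := by
  have e : bodyTemp v = 0 := by rw [bodyTemp, h]; rfl
  have := abs_mean_le hBm hB hv (bodyTemp v)
  rw [e, norm_zero, mul_zero] at this
  rw [e]
  exact abs_nonpos_iff.1 this

end Forms


/-! ### The mixed problem as an abstract saddle-point problem -/

theorem exists_lifting_of_basis {X : Type*} [NormedAddCommGroup X] [InnerProductSpace ℝ X]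
    {b : X →L[ℝ] Q} {S : Submodule ℝ X} {e f : X} (he0 : b e 0 = 1) (he1 : b e 1 = 0)
    (hf0 : b f 0 = 0) (hf1 : b f 1 = 1) (he : e ∈ S) (hf : f ∈ S) (z : Q) :
    ∃ v ∈ S, b v = z ∧ ‖v‖ ≤ (‖e‖ + ‖f‖ + 1) * ‖z‖ := by
  refine ⟨z 0 • e + z 1 • f, S.add_mem (S.smul_mem _ he) (S.smul_mem _ hf), ?_, ?_⟩
  · rw [map_add, map_smul, map_smul]
    ext i
    fin_cases i
    · simp [he0, hf0]
    · simp [he1, hf1]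
  · have h0 : ‖z 0‖ ≤ ‖z‖ := PiLp.norm_apply_le z 0
    have h1 : ‖z 1‖ ≤ ‖z‖ := PiLp.norm_apply_le z 1
    calc ‖z 0 • e + z 1 • f‖ ≤ ‖z 0‖ * ‖e‖ + ‖z 1‖ * ‖f‖ := by
          refine (norm_add_le _ _).trans (le_of_eq ?_)
          rw [norm_smul, norm_smul]
      _ ≤ ‖z‖ * ‖e‖ + ‖z‖ * ‖f‖ := by gcongr
      _ ≤ (‖e‖ + ‖f‖ + 1) * ‖z‖ := by linarith [norm_nonneg z]

section Translation

variable {d : ℕ} {Ω B₁ B₂ : Set (Space d)} {L κ κb ℓ β : ℝ}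
  {a : V Ω L →L[ℝ] V Ω L →L[ℝ] ℝ} {b : V Ω L →L[ℝ] Q} {Vh : Submodule ℝ (V Ω L)}

theorem formB_eq_inner
    (hb₀ : ∀ v : V Ω L, b v 0 = contRep L (wireTemp v) 0 - mean B₁ (bodyTemp v))
    (hb₁ : ∀ v : V Ω L, b v 1 = contRep L (wireTemp v) L - mean B₂ (bodyTemp v))
    (v : V Ω L) (Γ : Q) : formB B₁ B₂ v Γ = inner ℝ (b v) Γ := by
  rw [formB, ← hb₀, ← hb₁]
  simp [PiLp.inner_apply, Fin.sum_univ_two]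

theorem forall_formB_eq_zero_iff (hb : ∀ v Γ, formB B₁ B₂ v Γ = inner ℝ (b v) Γ) {v : V Ω L} :
    (∀ Γ : Q, formB B₁ B₂ v Γ = 0) ↔ b v = 0 := by
  simp only [hb]
  exact ⟨fun h => inner_self_eq_zero.1 (h (b v)), fun h Γ => by rw [h, inner_zero_left]⟩

theorem isMixedSolution_iff (ha : ∀ u v, a u v = formA κ κb u v)
    (hb : ∀ v Γ, formB B₁ B₂ v Γ = inner ℝ (b v) Γ) {F : V Ω L →L[ℝ] ℝ} {u : V Ω L} {y : Q} :
    IsMixedSolution κ κb B₁ B₂ F Vh u y ↔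
      u ∈ Vh ∧ (∀ v ∈ Vh, a u v + inner ℝ (b v) y = F v) ∧ b u = 0 := by
  refine and_congr Iff.rfl (and_congr ?_ (forall_formB_eq_zero_iff hb))
  simp only [ha, hb]

theorem kerBhT_eq (hb : ∀ v Γ, formB B₁ B₂ v Γ = inner ℝ (b v) Γ) :
    kerBhT B₁ B₂ Vh = ((Vh.map (b : V Ω L →ₗ[ℝ] Q))ᗮ : Submodule ℝ Q) := by
  ext Γ
  simp only [kerBhT, hb]
  exact mem_orthogonal_map_iff.symm

theorem infSup_iff (hb : ∀ v Γ, formB B₁ B₂ v Γ = inner ℝ (b v) Γ) :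
    InfSup ℓ B₁ B₂ Vh β ↔ IsInfSup b (normV ℓ) Vh β := by
  simp only [InfSup, IsInfSup, quotNorm, kerBhT_eq hb, hb]

theorem kerBhT_eq_zero (h : BhSurjective B₁ B₂ Vh) : kerBhT B₁ B₂ Vh = {0} := by
  ext Γ
  refine ⟨fun hΓ => ?_, fun hΓ v _ => ?_⟩
  · obtain ⟨v, hv, hvΓ⟩ := h Γ
    have h1 := hvΓ Γ
    rw [hΓ v hv] at h1
    exact inner_self_eq_zero.1 h1.symm
  · rw [mem_singleton_iff.1 hΓ]
    simp [formB]

theorem quotNorm_eq_norm (h : BhSurjective B₁ B₂ Vh) (Γ : Q) : quotNorm B₁ B₂ Vh Γ = ‖Γ‖ := by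
  rw [quotNorm, kerBhT_eq_zero h, Metric.infDist_singleton, dist_zero_right]

/-- Existence and uniqueness on a space on which `B_h` is surjective, from the existence and the
uniqueness modulo `ker B_hᵀ`. -/
theorem existsUnique_of_surjective (h : BhSurjective B₁ B₂ Vh) {F : V Ω L →L[ℝ] ℝ}
    (he : ∃ u y, IsMixedSolution κ κb B₁ B₂ F Vh u y)
    (hu : ∀ u y u' y', IsMixedSolution κ κb B₁ B₂ F Vh u y →
      IsMixedSolution κ κb B₁ B₂ F Vh u' y' → u = u' ∧ y - y' ∈ kerBhT B₁ B₂ Vh) :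
    ∃! s : V Ω L × Q, IsMixedSolution κ κb B₁ B₂ F Vh s.1 s.2 := by
  obtain ⟨u, y, hs⟩ := he
  refine ⟨(u, y), hs, fun s hs' => ?_⟩
  obtain ⟨h1, h2⟩ := hu _ _ _ _ hs' hs
  rw [kerBhT_eq_zero h] at h2
  exact Prod.ext h1 (sub_eq_zero.1 h2)

/-- The affine wire temperatures give a right inverse of `B_h` whose bound does not depend on the
space `Vh`. -/
theorem exists_uniform_lifting (hL : 0 < L)
    (hB₁m : MeasurableSet B₁) (hB₂m : MeasurableSet B₂) (hB₁ : B₁ ⊆ Ω) (hB₂ : B₂ ⊆ Ω)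
    (hv₁ : volume B₁ ≠ ⊤) (hv₂ : volume B₂ ≠ ⊤)
    (hb₀ : ∀ v : V Ω L, b v 0 = contRep L (wireTemp v) 0 - mean B₁ (bodyTemp v))
    (hb₁ : ∀ v : V Ω L, b v 1 = contRep L (wireTemp v) L - mean B₂ (bodyTemp v)) :
    ∃ E > 0, ∀ Vh : Submodule ℝ (V Ω L), ContainsAffineWire Vh →
      ∀ z : Q, ∃ v ∈ Vh, b v = z ∧ ‖v‖ ≤ E * ‖z‖ := by
  have key : ∀ p q : ℝ, ∃ e : V Ω L, (∀ Vh : Submodule ℝ (V Ω L), ContainsAffineWire Vh → e ∈ Vh) ∧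
      b e 0 = p ∧ b e 1 = q := by
    intro p q
    obtain ⟨e, he, hp, hq, hr⟩ := exists_affine_wire (Ω := Ω) hL p q
    refine ⟨e, fun Vh h => h e he hr, ?_, ?_⟩
    · rw [hb₀, hp, mean_bodyTemp_eq_zero hB₁m hB₁ hv₁ he, sub_zero]
    · rw [hb₁, hq, mean_bodyTemp_eq_zero hB₂m hB₂ hv₂ he, sub_zero]
  obtain ⟨e, he, he0, he1⟩ := key 1 0
  obtain ⟨f, hf, hf0, hf1⟩ := key 0 1
  exact ⟨‖e‖ + ‖f‖ + 1, by positivity, fun Vh hVh z =>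
    exists_lifting_of_basis he0 he1 hf0 hf1 (he Vh hVh) (hf Vh hVh) z⟩

end Translation

end LinkedWire

end

set_option maxHeartbeats 2000000 in
open LinkedWire in
theorem mainTheorem1 (d : ℕ) (Ω B₁ B₂ : Set (Space d)) (L ℓ κ κb : ℝ)
    (hΩo : IsOpen Ω) (hΩb : Bornology.IsBounded Ω)
    (hB₁m : MeasurableSet B₁) (hB₂m : MeasurableSet B₂)
    (hB₁ : B₁ ⊆ Ω) (hB₂ : B₂ ⊆ Ω) (hdisj : Disjoint B₁ B₂)
    (hB₁v : volume B₁ ≠ 0) (hB₂v : volume B₂ ≠ 0)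
    (hL : 0 < L) (hℓ : 0 < ℓ) (hκ : 0 < κ) (hκb : 0 < κb) :
    -- the continuous problem has exactly one solution
    (∀ F : V Ω L →L[ℝ] ℝ, ∃! s : V Ω L × Q,
      IsMixedSolution κ κb B₁ B₂ F ⊤ s.1 s.2) ∧
    -- `α`, `C`, `β₀` do not depend on the discrete space or on the load
    ∃ α > 0, ∃ C : ℝ → ℝ, ∃ β₀ > 0,
      -- every conforming space
      (∀ Vh : Submodule ℝ (V Ω L), IsClosed (Vh : Set (V Ω L)) →
        kerBh B₁ B₂ Vh ⊆ kerB Ω L B₁ B₂ ∧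
        (∀ v ∈ kerBh B₁ B₂ Vh, α * normV ℓ v ^ 2 ≤ formA κ κb v v) ∧
        (∃ β > 0, InfSup ℓ B₁ B₂ Vh β) ∧
        (∀ F : V Ω L →L[ℝ] ℝ,
          (∃ uh lamh, IsMixedSolution κ κb B₁ B₂ F Vh uh lamh) ∧
          (∀ uh lamh uh' lamh', IsMixedSolution κ κb B₁ B₂ F Vh uh lamh →
            IsMixedSolution κ κb B₁ B₂ F Vh uh' lamh' →
            uh = uh' ∧ lamh - lamh' ∈ kerBhT B₁ B₂ Vh)) ∧
        (∀ β > 0, InfSup ℓ B₁ B₂ Vh β →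
          ∀ (F : V Ω L →L[ℝ] ℝ) (uh : V Ω L) (lamh : Q),
            IsMixedSolution κ κb B₁ B₂ F Vh uh lamh →
            (∀ M : ℝ, 0 ≤ M → (∀ v ∈ Vh, |F v| ≤ M * normV ℓ v) →
              normV ℓ uh + quotNorm B₁ B₂ Vh lamh ≤ C β * M) ∧
            (∀ (u : V Ω L) (lam : Q), IsMixedSolution κ κb B₁ B₂ F ⊤ u lam →
              normV ℓ (u - uh) + quotNorm B₁ B₂ Vh (lam - lamh)
                ≤ C β * bestApprox ℓ Vh u))) ∧
      -- conforming spaces on which `B_h` is surjective: multipliers in the norm of `Q`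
      (∀ Vh : Submodule ℝ (V Ω L), IsClosed (Vh : Set (V Ω L)) → BhSurjective B₁ B₂ Vh →
        kerBhT B₁ B₂ Vh = {0} ∧
        (∀ F : V Ω L →L[ℝ] ℝ, ∃! s : V Ω L × Q,
          IsMixedSolution κ κb B₁ B₂ F Vh s.1 s.2) ∧
        (∀ β > 0, InfSup ℓ B₁ B₂ Vh β →
          ∀ (F : V Ω L →L[ℝ] ℝ) (uh : V Ω L) (lamh : Q),
            IsMixedSolution κ κb B₁ B₂ F Vh uh lamh →
            (∀ M : ℝ, 0 ≤ M → (∀ v ∈ Vh, |F v| ≤ M * normV ℓ v) →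
              normV ℓ uh + ‖lamh‖ ≤ C β * M) ∧
            (∀ (u : V Ω L) (lam : Q), IsMixedSolution κ κb B₁ B₂ F ⊤ u lam →
              normV ℓ (u - uh) + ‖lam - lamh‖ ≤ C β * bestApprox ℓ Vh u))) ∧
      -- conforming spaces that contain the affine wire temperatures: uniform constants
      (∀ Vh : Submodule ℝ (V Ω L), IsClosed (Vh : Set (V Ω L)) → ContainsAffineWire Vh →
        BhSurjective B₁ B₂ Vh ∧ InfSup ℓ B₁ B₂ Vh β₀ ∧
        (∀ F : V Ω L →L[ℝ] ℝ, ∃! s : V Ω L × Q,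
          IsMixedSolution κ κb B₁ B₂ F Vh s.1 s.2) ∧
        (∀ (F : V Ω L →L[ℝ] ℝ) (u uh : V Ω L) (lam lamh : Q),
          IsMixedSolution κ κb B₁ B₂ F ⊤ u lam → IsMixedSolution κ κb B₁ B₂ F Vh uh lamh →
            normV ℓ (u - uh) + ‖lam - lamh‖ ≤ C β₀ * bestApprox ℓ Vh u)) := by
  -- two disjoint nonempty sets do not fit into the one-point space of dimension zero
  obtain ⟨i⟩ : Nonempty (Fin d) := by
    obtain ⟨x, hx⟩ := nonempty_of_measure_ne_zero hB₁v
    obtain ⟨y, hy⟩ := nonempty_of_measure_ne_zero hB₂v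
    rcases Nat.eq_zero_or_pos d with rfl | hd
    · exact absurd hy (disjoint_left.1 hdisj (Subsingleton.elim x y ▸ hx))
    · exact ⟨⟨0, hd⟩⟩
  have hv₁ : volume B₁ ≠ ⊤ := (hΩb.subset hB₁).measure_lt_top.ne
  have hv₂ : volume B₂ ≠ ⊤ := (hΩb.subset hB₂).measure_lt_top.ne
  obtain ⟨b, hb₀, hb₁⟩ := exists_formB_clm (Ω := Ω) hL hB₁m hB₂m hB₁ hB₂ hv₁ hv₂
  have hb := formB_eq_inner hb₀ hb₁
  have ha : ∀ u v, formAL Ω L κ κb u v = formA κ κb u v := formAL_apply κ κb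
  obtain ⟨c₁, hc₁, c₂, hc₂, hN⟩ := exists_normV_equiv (d := d) (Ω := Ω) hL hℓ
  have hN₁ := fun v => (hN v).1
  have hN₂ := fun v => (hN v).2
  have hN0 : ∀ v : V Ω L, 0 ≤ normV ℓ v := fun v => Real.sqrt_nonneg _
  obtain ⟨α, hα, hco⟩ := exists_coercive (L := L) i hΩb hB₁m hB₁ hL hκ hκb
  have hcob : ∀ v, b v = 0 → α * ‖v‖ ^ 2 ≤ formA κ κb v v := fun v hv => hco v (by
    have h := hb₀ v
    rw [hv] at h
    exact sub_eq_zero.1 h.symm)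
  have hcoa : ∀ v, b v = 0 → α * ‖v‖ ^ 2 ≤ formAL Ω L κ κb v v := fun v hv => by
    rw [ha]; exact hcob v hv
  have hcoN : ∀ v, b v = 0 → α / c₂ ^ 2 * normV ℓ v ^ 2 ≤ formA κ κb v v := fun v hv => by
    refine le_trans ?_ (hcob v hv)
    have h := pow_le_pow_left₀ (hN0 v) (hN₂ v) 2
    calc α / c₂ ^ 2 * normV ℓ v ^ 2 ≤ α / c₂ ^ 2 * (c₂ * ‖v‖) ^ 2 := by gcongr
      _ = α * ‖v‖ ^ 2 := by field_simp
  have hcoNa : ∀ v, b v = 0 → α / c₂ ^ 2 * normV ℓ v ^ 2 ≤ formAL Ω L κ κb v v := fun v hv => by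
    rw [ha]; exact hcoN v hv
  have hα' : 0 < α / c₂ ^ 2 := by positivity
  obtain ⟨E, hE, hlift⟩ := exists_uniform_lifting hL hB₁m hB₂m hB₁ hB₂ hv₁ hv₂ hb₀ hb₁
  -- solvability on a closed subspace, and uniqueness modulo the kernel of the transpose
  have hex : ∀ Vh : Submodule ℝ (V Ω L), IsClosed (Vh : Set (V Ω L)) →
      ∀ F : V Ω L →L[ℝ] ℝ, ∃ uh lamh, IsMixedSolution κ κb B₁ B₂ F Vh uh lamh := by
    intro Vh hVh F
    obtain ⟨u, hu, hbu, y, hy⟩ := exists_saddle_point hα hcoa hVh F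
    exact ⟨u, y, (isMixedSolution_iff ha hb).2 ⟨hu, hy, hbu⟩⟩
  have hun : ∀ (Vh : Submodule ℝ (V Ω L)) (F : V Ω L →L[ℝ] ℝ), ∀ uh lamh uh' lamh',
      IsMixedSolution κ κb B₁ B₂ F Vh uh lamh → IsMixedSolution κ κb B₁ B₂ F Vh uh' lamh' →
      uh = uh' ∧ lamh - lamh' ∈ kerBhT B₁ B₂ Vh := by
    intro Vh F u y u' y' h h'
    obtain ⟨hu, hs, hbu⟩ := (isMixedSolution_iff ha hb).1 h
    obtain ⟨hu', hs', hbu'⟩ := (isMixedSolution_iff ha hb).1 h'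
    rw [kerBhT_eq hb]
    exact saddle_point_unique hα hcoa hu hu' hbu hbu' hs hs'
  have hsurj : ∀ Vh : Submodule ℝ (V Ω L), ContainsAffineWire Vh → BhSurjective B₁ B₂ Vh := by
    intro Vh hVh q
    obtain ⟨v, hv, hbv, -⟩ := hlift Vh hVh q
    exact ⟨v, hv, fun Γ => by rw [hb, hbv]⟩
  have hinf : ∀ Vh : Submodule ℝ (V Ω L), ContainsAffineWire Vh →
      InfSup ℓ B₁ B₂ Vh (c₂ * E)⁻¹ := by
    intro Vh hVh
    refine (infSup_iff hb).2 (isInfSup_of_lifting hc₁ hN₁ (by positivity) fun z _ => ?_)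
    obtain ⟨v, hv, hbv, hvz⟩ := hlift Vh hVh z
    refine ⟨v, hv, hbv, (hN₂ v).trans ?_⟩
    rw [mul_assoc]
    gcongr
  obtain ⟨C, hC⟩ := exists_saddle_point_const hα hcoa hα' hcoNa hc₁ hN₁ hc₂ hN₂
  have hest : ∀ Vh : Submodule ℝ (V Ω L), IsClosed (Vh : Set (V Ω L)) →
      ∀ β > 0, InfSup ℓ B₁ B₂ Vh β →
      ∀ (F : V Ω L →L[ℝ] ℝ) (uh : V Ω L) (lamh : Q), IsMixedSolution κ κb B₁ B₂ F Vh uh lamh →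
        (∀ M : ℝ, 0 ≤ M → (∀ v ∈ Vh, |F v| ≤ M * normV ℓ v) →
          normV ℓ uh + quotNorm B₁ B₂ Vh lamh ≤ C β * M) ∧
        (∀ (u : V Ω L) (lam : Q), IsMixedSolution κ κb B₁ B₂ F ⊤ u lam →
          normV ℓ (u - uh) + quotNorm B₁ B₂ Vh (lam - lamh)
            ≤ C β * bestApprox ℓ Vh u) := by
    intro Vh hVh β hβ hI F uh yh h
    obtain ⟨h1, h2⟩ := hC Vh hVh β hβ ((infSup_iff hb).1 hI) F uh yh
      ((isMixedSolution_iff ha hb).1 h)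
    simp only [quotNorm, kerBhT_eq hb]
    refine ⟨h1, fun u y hu => ?_⟩
    obtain ⟨-, hs, hbu⟩ := (isMixedSolution_iff ha hb).1 hu
    exact h2 u y (fun v _ => hs v trivial) hbu
  have htop : IsClosed ((⊤ : Submodule ℝ (V Ω L)) : Set (V Ω L)) := isClosed_univ
  refine ⟨fun F => existsUnique_of_surjective (hsurj ⊤ fun _ _ _ => trivial) (hex ⊤ htop F)
    (hun ⊤ F), α / c₂ ^ 2, hα', C, (c₂ * E)⁻¹, by positivity, ?_, ?_, ?_⟩
  · intro Vh hVh
    refine ⟨fun v hv => hv.2, fun v hv => hcoN v ((forall_formB_eq_zero_iff hb).1 hv.2), ?_,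
      fun F => ⟨hex Vh hVh F, hun Vh F⟩, hest Vh hVh⟩
    obtain ⟨β, hβ, h⟩ := exists_isInfSup (b := b) (S := Vh) hc₁ hN₁ hc₂ hN₂
    exact ⟨β, hβ, (infSup_iff hb).2 h⟩
  · intro Vh hVh hs
    refine ⟨kerBhT_eq_zero hs, fun F => existsUnique_of_surjective hs (hex Vh hVh F) (hun Vh F), ?_⟩
    intro β hβ hI F uh yh h
    simpa only [quotNorm_eq_norm hs] using hest Vh hVh β hβ hI F uh yh h
  · intro Vh hVh hA
    have hs := hsurj Vh hA
    refine ⟨hs, hinf Vh hA,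
      fun F => existsUnique_of_surjective hs (hex Vh hVh F) (hun Vh F), ?_⟩
    intro F u uh y yh hu huh
    have key := (hest Vh hVh _ (by positivity) (hinf Vh hA) F uh yh huh).2 u y hu
    rwa [quotNorm_eq_norm hs] at key
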